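/- Let $k\ge 1$ and let $\Lambda$ be a row-finite $k$-graph without sources: a countable category with a degree functor $d:\Lambda\to\mathbb N^k$ such that whenever $d(\lambda)=m+n$ there are unique $\mu,\nu$ with $d(\mu)=m$, $d(\nu)=n$ and $\lambda=\mu\nu$, and such that for every vertex (object) $v$ and every $n\in\mathbb N^k$ the set $v\Lambda^n$ of morphisms of degree $n$ with range (codomain) $v$ is finite and nonempty. Write $r,s$ for the range and source maps, and identify a vertex $v$ with its identity morphism. Let $\mathrm{KP}_{\mathbb C}(\Lambda)$ be the Kumjian–Pask algebra, i.e. the (not necessarily unital) $\mathbb C$-algebra generated by symbols $p_v$ ($v\in\Lambda^0$) and $s_\lambda,s_{\lambda^*}$ ($\lambda\in\Lambda$, $d(\lambda)\neq0$) subject to: (KP1) $p_vp_w=\delta_{v,w}p_v$; (KP2) $s_\lambda s_\mu=s_{\lambda\mu}$ and $s_{\mu^*}s_{\lambda^*}=s_{(\lambda\mu)^*}$ if $s(\lambda)=r(\mu)$, and $p_{r(\lambda)}s_\lambda=s_\lambda=s_\lambda p_{s(\lambda)}$, $p_{s(\lambda)}s_{\lambda^*}=s_{\lambda^*}=s_{\lambda^*}p_{r(\lambda)}$;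 (KP3) $s_{\lambda^*}s_\mu=\delta_{\lambda,\mu}p_{s(\lambda)}$ if $d(\lambda)=d(\mu)$; (KP4) $p_v=\sum_{\lambda\in v\Lambda^n}s_\lambda s_{\lambda^*}$ for $n\neq0$. Put $s_v=s_{v^*}=p_v$ for vertices $v$. This algebra carries the conjugate-linear involution with $(c\,s_\lambda s_{\mu^*})^*=\bar c\,s_\mu s_{\lambda^*}$. Let $C^*(\Lambda)$ be the $C^*$-algebra generated by the universal Cuntz–Krieger family $\{t_\lambda:\lambda\in\Lambda\}$ (with $q_v:=t_v$ for vertices $v$), that is, the Hausdorff completion, in the seminorm $\sup\{\|\pi(a)\|:\pi \text{ a } *\text{-representation on a Hilbert space}\}$, of the $*$-algebra generated by partial isometries $t_\lambda$ such that the $q_v$ are mutually orthogonal projections, $t_\lambda t_\mu=t_{\lambda\mu}$ if $s(\lambda)=r(\mu)$, $t_\lambda^*t_\lambda=q_{s(\lambda)}$, and $q_v=\sum_{\lambda\in v\Lambda^n}t_\lambda t_\lambda^*$ for all $v\in\Lambda^0$ and $n\in\mathbb N^k$. Then there is a $*$-homomorphism $\pi_{q,t}:\mathrm{KP}_{\mathbb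 C}(\Lambda)\to C^*(\Lambda)$ with $\pi_{q,t}(s_\lambda)=t_\lambda$ and $\pi_{q,t}(s_{\lambda^*})=t_\lambda^*$ for all $\lambda\in\Lambda$; it is the only algebra homomorphism with these values, and $\pi_{q,t}(s_\lambda s_{\mu^*})=t_\lambda t_\mu^*$ for all $\lambda,\mu\in\Lambda$. It is a $*$-isomorphism of $\mathrm{KP}_{\mathbb C}(\Lambda)$ onto the $*$-subalgebra $$A:=\operatorname{span}\{t_\lambda t_\mu^*:\lambda,\mu\in\Lambda\},$$ which is dense in $C^*(\Lambda)$. Moreover, the subspaces $$A_n:=\operatorname{span}\{t_\lambda t_\mu^*:\lambda,\mu\in\Lambda,\ d(\lambda)-d(\mu)=n\}\qquad(n\in\mathbb Z^k)$$ form a $\mathbb Z^k$-grading of $A$: $A_mA_n\subset A_{m+n}$, and $A$ is the internal direct sum of the $A_n$. -/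

import Mathlib

open CategoryTheory
open scoped ENNReal

universe u v w

noncomputable section

/-- A graph of rank `k` (`k`-graph): a countable category with a degree functor into the additive
monoid `ℕ^k` (a category with one object) that has the factorization property.  The objects are the
vertices, the morphisms `f : a ⟶ b` are the paths with source (domain) `a` and range (codomain) `b`.
The composite written `λμ` on paper (`s(λ) = r(μ)`) is `μ ≫ λ` in Mathlib's notation. -/
structure KGraph (k : ℕ) where
  /-- the vertices -/
  Vertex : Type u
  [category : Category.{v} Vertex]
  countable : Countable (Σ a b : Vertex, (a ⟶ b))
  /-- the degree of a morphism -/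
  degree : ∀ {a b : Vertex}, (a ⟶ b) → (Fin k → ℕ)
  degree_id : ∀ a : Vertex, degree (𝟙 a) = 0
  degree_comp : ∀ {a b c : Vertex} (g : a ⟶ b) (f : b ⟶ c), degree (g ≫ f) = degree f + degree g
  factorization : ∀ {a b : Vertex} (f : a ⟶ b) (m n : Fin k → ℕ), degree f = m + n →
    ∃! t : (Σ c : Vertex, (c ⟶ b) × (a ⟶ c)),
      degree t.2.1 = m ∧ degree t.2.2 = n ∧ t.2.2 ≫ t.2.1 = f

attribute [instance] KGraph.category

namespace KGraph

variable {k : ℕ}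

/-- The set `Λ` of all morphisms (finite paths) of a `k`-graph. -/
def Path (Λ : KGraph.{u, v} k) : Type (max u v) := Σ a b : Λ.Vertex, (a ⟶ b)

variable (Λ : KGraph.{u, v} k)

namespace Path

variable {Λ}

/-- A morphism as an element of the set of all paths. -/
def mk {a b : Λ.Vertex} (f : a ⟶ b) : Λ.Path := ⟨a, b, f⟩

/-- The source `s(p)`. -/
def src (p : Λ.Path) : Λ.Vertex := p.1

/-- The range `r(p)`. -/
def rng (p : Λ.Path) : Λ.Vertex := p.2.1

/-- The degree `d(p)`. -/
def deg (p : Λ.Path) : Fin k → ℕ := Λ.degree p.2.2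

/-- The identity path at a vertex. -/
def vert (x : Λ.Vertex) : Λ.Path := mk (𝟙 x)

end Path

/-- The set `vΛⁿ` of the paths of degree `n` with range `x`. -/
def pathsTo (x : Λ.Vertex) (n : Fin k → ℕ) : Set Λ.Path := {p | p.rng = x ∧ p.deg = n}

/-- `Λ` is row-finite: every `vΛⁿ` is finite. -/
def RowFinite : Prop := ∀ (x : Λ.Vertex) (n : Fin k → ℕ), (Λ.pathsTo x n).Finite

/-- `Λ` has no sources: every `vΛⁿ` is nonempty. -/
def NoSources : Prop := ∀ (x : Λ.Vertex) (n : Fin k → ℕ), (Λ.pathsTo x n).Nonempty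

/-! ### The Kumjian-Pask algebra -/

/-- The set `X = Λ⁰ ∪ Λ^{≠0} ∪ G(Λ^{≠0})` of generators: vertices, paths of nonzero degree, and
ghost paths `p*` of paths `p` of nonzero degree. -/
inductive Gen : Type (max u v)
  | vertex (x : Λ.Vertex) : Gen
  | path (p : Λ.Path) (hp : p.deg ≠ 0) : Gen
  | ghost (p : Λ.Path) (hp : p.deg ≠ 0) : Gen

/-- The free (non-unital) `R`-algebra on `X`: the free module on the nonempty words in `X`,
multiplied by concatenation. -/
abbrev FreeAlg (R : Type w) [CommRing R] : Type (max u v w) :=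
  MonoidAlgebra R (FreeSemigroup Λ.Gen)

/-- A generator as an element of the free algebra. -/
def FreeAlg.ι (R : Type w) [CommRing R] (x : Λ.Gen) : Λ.FreeAlg R :=
  MonoidAlgebra.single (FreeSemigroup.of x) 1

variable {Λ} in
theorem deg_comp_ne_zero {a b c : Λ.Vertex} {f : b ⟶ c} {g : a ⟶ b}
    (hf : (Path.mk f).deg ≠ 0) : (Path.mk (g ≫ f)).deg ≠ 0 := by
  intro h
  apply hf
  have h1 : Λ.degree f + Λ.degree g = 0 := (Λ.degree_comp g f).symm.trans h
  exact (add_eq_zero.mp h1).1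

variable {Λ} in
theorem deg_ne_zero_of_mem {x : Λ.Vertex} {n : Fin k → ℕ} (hn : n ≠ 0) (p : Λ.pathsTo x n) :
    p.1.deg ≠ 0 := by
  rw [p.2.2]; exact hn

open FreeAlg in
/-- The elements of the free algebra that have to vanish, that is, the Kumjian-Pask relations.  The
sum in `kp4` is a finite sum if `Λ` is row-finite. -/
inductive KPRelator (R : Type w) [CommRing R] : Λ.FreeAlg R → Prop
  | kp1_same (x : Λ.Vertex) : KPRelator R (ι Λ R (.vertex x) * ι Λ R (.vertex x) - ι Λ R (.vertex x))
  | kp1_ne (x y : Λ.Vertex) (h : x ≠ y) : KPRelator R (ι Λ R (.vertex x) * ι Λ R (.vertex y))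
  | kp2_path {a b c : Λ.Vertex} (f : b ⟶ c) (g : a ⟶ b)
      (hf : (Path.mk f).deg ≠ 0) (hg : (Path.mk g).deg ≠ 0) :
      KPRelator R (ι Λ R (.path (Path.mk f) hf) * ι Λ R (.path (Path.mk g) hg)
        - ι Λ R (.path (Path.mk (g ≫ f)) (deg_comp_ne_zero hf)))
  | kp2_ghost {a b c : Λ.Vertex} (f : b ⟶ c) (g : a ⟶ b)
      (hf : (Path.mk f).deg ≠ 0) (hg : (Path.mk g).deg ≠ 0) :
      KPRelator R (ι Λ R (.ghost (Path.mk g) hg) * ι Λ R (.ghost (Path.mk f) hf)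
        - ι Λ R (.ghost (Path.mk (g ≫ f)) (deg_comp_ne_zero hf)))
  | kp2_rng_path (p : Λ.Path) (hp : p.deg ≠ 0) :
      KPRelator R (ι Λ R (.vertex p.rng) * ι Λ R (.path p hp) - ι Λ R (.path p hp))
  | kp2_path_src (p : Λ.Path) (hp : p.deg ≠ 0) :
      KPRelator R (ι Λ R (.path p hp) * ι Λ R (.vertex p.src) - ι Λ R (.path p hp))
  | kp2_src_ghost (p : Λ.Path) (hp : p.deg ≠ 0) :
      KPRelator R (ι Λ R (.vertex p.src) * ι Λ R (.ghost p hp) - ι Λ R (.ghost p hp))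
  | kp2_ghost_rng (p : Λ.Path) (hp : p.deg ≠ 0) :
      KPRelator R (ι Λ R (.ghost p hp) * ι Λ R (.vertex p.rng) - ι Λ R (.ghost p hp))
  | kp3_same (p : Λ.Path) (hp : p.deg ≠ 0) :
      KPRelator R (ι Λ R (.ghost p hp) * ι Λ R (.path p hp) - ι Λ R (.vertex p.src))
  | kp3_ne (p q : Λ.Path) (hp : p.deg ≠ 0) (hq : q.deg ≠ 0) (hd : p.deg = q.deg) (hne : p ≠ q) :
      KPRelator R (ι Λ R (.ghost p hp) * ι Λ R (.path q hq))
  | kp4 (x : Λ.Vertex) (n : Fin k → ℕ) (hn : n ≠ 0) :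
      KPRelator R (ι Λ R (.vertex x) - ∑ᶠ p : Λ.pathsTo x n,
        ι Λ R (.path p.1 (deg_ne_zero_of_mem hn p)) * ι Λ R (.ghost p.1 (deg_ne_zero_of_mem hn p)))

/-- The ideal of the `R`-algebra `FreeAlg R` generated by the relators, i.e. the smallest two-sided
ring ideal that is closed under multiplication by scalars and contains the relators. -/
def kpIdeal (R : Type w) [CommRing R] : TwoSidedIdeal (Λ.FreeAlg R) :=
  sInf {I | (∀ (r : R) (x : Λ.FreeAlg R), x ∈ I → r • x ∈ I) ∧ ∀ x, Λ.KPRelator R x → x ∈ I}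

theorem smul_mem_kpIdeal {R : Type w} [CommRing R] (r : R) {x : Λ.FreeAlg R}
    (hx : x ∈ Λ.kpIdeal R) : r • x ∈ Λ.kpIdeal R := by
  rw [kpIdeal, TwoSidedIdeal.mem_sInf] at hx ⊢
  exact fun I hI => hI.1 r x (hx I hI)

/-- The Kumjian-Pask algebra `KP_R(Λ)`: the free algebra modulo the Kumjian-Pask relations. -/
def KP (R : Type w) [CommRing R] : Type (max u v w) := (Λ.kpIdeal R).ringCon.Quotient

namespace KP

variable (R : Type w) [CommRing R]

instance : NonUnitalRing (Λ.KP R) :=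
  inferInstanceAs (NonUnitalRing (Λ.kpIdeal R).ringCon.Quotient)

/-- The quotient map. -/
def mk : Λ.FreeAlg R →ₙ+* Λ.KP R where
  toFun x := ((x : (Λ.kpIdeal R).ringCon.Quotient))
  map_mul' _ _ := rfl
  map_zero' := rfl
  map_add' _ _ := rfl

theorem mk_surjective : Function.Surjective (mk Λ R) := Quotient.mk''_surjective

instance : SMul R (Λ.KP R) where
  smul r := Quotient.map' (fun x => r • x) fun x y h => by
    have h' : x - y ∈ Λ.kpIdeal R := (TwoSidedIdeal.rel_iff _ x y).mp h
    refine (TwoSidedIdeal.rel_iff _ (r • x) (r • y)).mpr ?_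
    rw [← smul_sub]
    exact Λ.smul_mem_kpIdeal r h'

theorem mk_smul (r : R) (x : Λ.FreeAlg R) : mk Λ R (r • x) = r • mk Λ R x := rfl

instance : Module R (Λ.KP R) :=
  Function.Surjective.module R (mk Λ R : Λ.FreeAlg R →+ Λ.KP R) (mk_surjective Λ R) (mk_smul Λ R)

instance : IsScalarTower R (Λ.KP R) (Λ.KP R) where
  smul_assoc r x y := by
    obtain ⟨x, rfl⟩ := mk_surjective Λ R x
    obtain ⟨y, rfl⟩ := mk_surjective Λ R y
    simp only [smul_eq_mul, ← mk_smul, ← map_mul, smul_mul_assoc]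

instance : SMulCommClass R (Λ.KP R) (Λ.KP R) where
  smul_comm r x y := by
    obtain ⟨x, rfl⟩ := mk_surjective Λ R x
    obtain ⟨y, rfl⟩ := mk_surjective Λ R y
    simp only [smul_eq_mul, ← mk_smul, ← map_mul, mul_smul_comm]

end KP

/-! ### The involution on the Kumjian-Pask algebra -/

/-- `v ↦ v`, `p ↦ p*`, `p* ↦ p` on generators. -/
def Gen.flip : Λ.Gen → Λ.Gen
  | .vertex x => .vertex x
  | .path p hp => .ghost p hp
  | .ghost p hp => .path p hp

theorem Gen.flip_flip (x : Λ.Gen) : Gen.flip Λ (Gen.flip Λ x) = x := by cases x <;> rfl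

/-- The anti-automorphism of the words in `X` that reverses a word and flips its letters. -/
def wordStar : FreeSemigroup Λ.Gen →ₙ* (FreeSemigroup Λ.Gen)ᵐᵒᵖ :=
  FreeSemigroup.lift fun x => MulOpposite.op (FreeSemigroup.of (Gen.flip Λ x))

instance : StarMul (FreeSemigroup Λ.Gen) where
  star x := (Λ.wordStar x).unop
  star_involutive x := by
    induction x using FreeSemigroup.recOnMul with
    | ih1 x => simp [wordStar, Gen.flip_flip]
    | ih2 x y hx hy => simp only [map_mul, MulOpposite.unop_mul] at *; simp_all
  star_mul x y := by simp

theorem word_star_of (x : Λ.Gen) :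
    star (FreeSemigroup.of x) = FreeSemigroup.of (Gen.flip Λ x) := rfl

section Involution

variable (R : Type w) [CommRing R] [StarRing R]

/-- The conjugate-linear involution of the free algebra: `∑ c_w w ↦ ∑ (star c_w) w*`. -/
def freeStar : Λ.FreeAlg R →+ Λ.FreeAlg R :=
  (Finsupp.liftAddHom fun w : FreeSemigroup Λ.Gen =>
    (MonoidAlgebra.singleAddHom (star w)).comp (starAddEquiv (R := R)).toAddMonoidHom).comp
    MonoidAlgebra.coeffAddEquiv.toAddMonoidHom

theorem freeStar_single (w : FreeSemigroup Λ.Gen) (r : R) :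
    Λ.freeStar R (MonoidAlgebra.single w r) = MonoidAlgebra.single (star w) (star r) := by
  simp [freeStar]

instance : StarRing (Λ.FreeAlg R) where
  star := Λ.freeStar R
  star_add := map_add _
  star_involutive x := by
    change Λ.freeStar R (Λ.freeStar R x) = x
    induction x using MonoidAlgebra.induction_linear with
    | zero => simp
    | add x y hx hy => rw [map_add, map_add, hx, hy]
    | single m r => simp [freeStar_single]
  star_mul x y := by
    change Λ.freeStar R (x * y) = Λ.freeStar R y * Λ.freeStar R x
    induction x using MonoidAlgebra.induction_linear with
    | zero => simp
    | add x y hx hy => rw [add_mul, map_add, map_add, hx, hy, mul_add]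
    | single m r =>
      induction y using MonoidAlgebra.induction_linear with
      | zero => simp
      | add x y hx hy => rw [mul_add, map_add, map_add, hx, hy, add_mul]
      | single n t => simp [freeStar_single, mul_comm]

theorem FreeAlg.star_smul (r : R) (x : Λ.FreeAlg R) : star (r • x) = star r • star x := by
  change Λ.freeStar R (r • x) = star r • Λ.freeStar R x
  induction x using MonoidAlgebra.induction_linear with
  | zero => simp
  | add x y hx hy => rw [smul_add, map_add, map_add, hx, hy, smul_add]
  | single m t =>
    simp [freeStar_single, MonoidAlgebra.smul_single]

theorem FreeAlg.star_ι (x : Λ.Gen) : star (FreeAlg.ι Λ R x) = FreeAlg.ι Λ R (Gen.flip Λ x) := by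
  change Λ.freeStar R _ = _
  simp [FreeAlg.ι, freeStar_single, word_star_of]

theorem KPRelator.star {x : Λ.FreeAlg R} (hx : Λ.KPRelator R x) : Λ.KPRelator R (star x) := by
  cases hx with
  | kp1_same x => simpa [FreeAlg.star_ι, Gen.flip] using KPRelator.kp1_same x
  | kp1_ne x y h => simpa [FreeAlg.star_ι, Gen.flip] using KPRelator.kp1_ne y x h.symm
  | kp2_path f g hf hg => simpa [FreeAlg.star_ι, Gen.flip] using KPRelator.kp2_ghost f g hf hg
  | kp2_ghost f g hf hg => simpa [FreeAlg.star_ι, Gen.flip] using KPRelator.kp2_path f g hf hg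
  | kp2_rng_path p hp => simpa [FreeAlg.star_ι, Gen.flip] using KPRelator.kp2_ghost_rng p hp
  | kp2_path_src p hp => simpa [FreeAlg.star_ι, Gen.flip] using KPRelator.kp2_src_ghost p hp
  | kp2_src_ghost p hp => simpa [FreeAlg.star_ι, Gen.flip] using KPRelator.kp2_path_src p hp
  | kp2_ghost_rng p hp => simpa [FreeAlg.star_ι, Gen.flip] using KPRelator.kp2_rng_path p hp
  | kp3_same p hp => simpa [FreeAlg.star_ι, Gen.flip] using KPRelator.kp3_same p hp
  | kp3_ne p q hp hq hd hne =>
    simpa [FreeAlg.star_ι, Gen.flip] using KPRelator.kp3_ne q p hq hp hd.symm hne.symm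
  | kp4 x n hn =>
    have h := KPRelator.kp4 (R := R) x n hn
    have key : ∀ f : Λ.pathsTo x n → Λ.FreeAlg R, Star.star (∑ᶠ p, f p) = ∑ᶠ p, Star.star (f p) :=
      fun f => (starAddEquiv (R := Λ.FreeAlg R)).map_finsum f
    rw [star_sub, key]
    simpa [FreeAlg.star_ι, Gen.flip] using h

theorem star_mem_kpIdeal {x : Λ.FreeAlg R} (hx : x ∈ Λ.kpIdeal R) : star x ∈ Λ.kpIdeal R := by
  rw [kpIdeal, TwoSidedIdeal.mem_sInf] at hx ⊢
  intro I hI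
  let J : TwoSidedIdeal (Λ.FreeAlg R) := TwoSidedIdeal.mk' {y | star y ∈ I}
    (by simp [I.zero_mem])
    (fun {x y} hx hy => by simpa using I.add_mem hx hy)
    (fun {x} hx => by simpa using I.neg_mem hx)
    (fun {x y} hy => by simpa using I.mul_mem_right _ _ hy)
    (fun {x y} hx => by simpa using I.mul_mem_left _ _ hx)
  have hJ : ∀ y, y ∈ J ↔ star y ∈ I := fun y => by simp [J, TwoSidedIdeal.mem_mk']
  refine (hJ x).mp (hx J ⟨fun r y hy => ?_, fun y hy => ?_⟩)
  · rw [hJ, FreeAlg.star_smul]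
    exact hI.1 _ _ ((hJ y).mp hy)
  · exact (hJ y).mpr (hI.2 _ (KPRelator.star Λ R hy))

namespace KP

instance : Star (Λ.KP R) where
  star := Quotient.map' (fun x => star x) fun x y h => by
    have h' : x - y ∈ Λ.kpIdeal R := (TwoSidedIdeal.rel_iff _ x y).mp h
    refine (TwoSidedIdeal.rel_iff _ (star x) (star y)).mpr ?_
    rw [← star_sub]
    exact Λ.star_mem_kpIdeal R h'

theorem mk_star (x : Λ.FreeAlg R) : mk Λ R (star x) = star (mk Λ R x) := rfl

instance : StarRing (Λ.KP R) where
  star_involutive x := by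
    obtain ⟨x, rfl⟩ := mk_surjective Λ R x
    simp only [← mk_star, star_star]
  star_mul x y := by
    obtain ⟨x, rfl⟩ := mk_surjective Λ R x
    obtain ⟨y, rfl⟩ := mk_surjective Λ R y
    simp only [← mk_star, ← map_mul, star_mul]
  star_add x y := by
    obtain ⟨x, rfl⟩ := mk_surjective Λ R x
    obtain ⟨y, rfl⟩ := mk_surjective Λ R y
    simp only [← mk_star, ← map_add, star_add]

instance : StarModule R (Λ.KP R) where
  star_smul r x := by
    obtain ⟨x, rfl⟩ := mk_surjective Λ R x
    simp only [← mk_star, ← mk_smul, FreeAlg.star_smul]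

end KP

end Involution

namespace KP

variable (R : Type w) [CommRing R]

open Classical in
/-- The element `s_p` of the universal Kumjian-Pask family, with the convention `s_v = p_v` for the
identity path at a vertex `v` (a path of degree `0` is the identity path at its range). -/
def s (p : Λ.Path) : Λ.KP R :=
  if hp : p.deg = 0 then mk Λ R (FreeAlg.ι Λ R (.vertex p.rng))
  else mk Λ R (FreeAlg.ι Λ R (.path p hp))

open Classical in
/-- The element `s_{p*}` of the universal Kumjian-Pask family, with the convention `s_{v*} = p_v`
for the identity path at a vertex `v`. -/
def sGhost (p : Λ.Path) : Λ.KP R :=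
  if hp : p.deg = 0 then mk Λ R (FreeAlg.ι Λ R (.vertex p.rng))
  else mk Λ R (FreeAlg.ι Λ R (.ghost p hp))

end KP

/-! ### The C*-algebra of a `k`-graph -/

/-- A Cuntz-Krieger `Λ`-family in a `*`-algebra: partial isometries `S_p`, one for each path `p`
(with `S_v` belonging to the identity path at `v`), that satisfy the relations of Kumjian and Pask.
The sum in `sum_range` is a finite sum if `Λ` is row-finite. -/
structure IsCKFamily {A : Type w} [NonUnitalRing A] [StarRing A] (S : Λ.Path → A) : Prop where
  partial_isometry : ∀ p : Λ.Path, S p * star (S p) * S p = S p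
  vert_star : ∀ x : Λ.Vertex, star (S (Path.vert x)) = S (Path.vert x)
  vert_idem : ∀ x : Λ.Vertex, S (Path.vert x) * S (Path.vert x) = S (Path.vert x)
  vert_orthogonal : ∀ x y : Λ.Vertex, x ≠ y → S (Path.vert x) * S (Path.vert y) = 0
  comp : ∀ {a b c : Λ.Vertex} (f : b ⟶ c) (g : a ⟶ b),
    S (Path.mk f) * S (Path.mk g) = S (Path.mk (g ≫ f))
  star_mul_self : ∀ p : Λ.Path, star (S p) * S p = S (Path.vert p.src)
  sum_range : ∀ (x : Λ.Vertex) (n : Fin k → ℕ),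
    S (Path.vert x) = ∑ᶠ p : Λ.pathsTo x n, S p.1 * star (S p.1)

/-- A Cuntz-Krieger `Λ`-family of bounded operators on a Hilbert space; equivalently, a
`*`-representation on a Hilbert space of the `*`-algebra that is generated by symbols `t_p`
subject to the Cuntz-Krieger relations. -/
structure CKRep : Type (max u v + 1) where
  H : Type (max u v)
  [normedAddCommGroup : NormedAddCommGroup H]
  [innerProductSpace : InnerProductSpace ℂ H]
  [completeSpace : CompleteSpace H]
  S : Λ.Path → (H →L[ℂ] H)
  isCKFamily : Λ.IsCKFamily S

attribute [instance] CKRep.normedAddCommGroup CKRep.innerProductSpace CKRep.completeSpace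

variable {Λ} in
theorem IsCKFamily.norm_le_one {A : Type w} [NonUnitalCStarAlgebra A] {S : Λ.Path → A}
    (hS : Λ.IsCKFamily S) (p : Λ.Path) : ‖S p‖ ≤ 1 := by
  have hv : ∀ x : Λ.Vertex, ‖S (Path.vert x)‖ ≤ 1 := fun x => by
    have h := CStarRing.norm_star_mul_self (x := S (Path.vert x))
    rw [hS.vert_star, hS.vert_idem] at h
    nlinarith [norm_nonneg (S (Path.vert x))]
  have h := CStarRing.norm_star_mul_self (x := S p)
  rw [hS.star_mul_self] at h
  nlinarith [norm_nonneg (S p), hv p.src]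

/-- The `ℓ^∞`-direct sum, with the supremum norm, of the algebras `B(H)` over all Cuntz-Krieger
`Λ`-families on Hilbert spaces `H`. -/
def RepProduct : Type (max u v + 1) := lp (fun π : Λ.CKRep => π.H →L[ℂ] π.H) ∞

instance : NonUnitalCStarAlgebra Λ.RepProduct :=
  inferInstanceAs (NonUnitalCStarAlgebra (lp (fun π : Λ.CKRep => π.H →L[ℂ] π.H) ∞))

/-- The universal family `(S_p)_S` in the direct sum. -/
def universalFamily (p : Λ.Path) : Λ.RepProduct :=
  ⟨fun π => π.S p, memℓp_infty ⟨1, by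
    rintro _ ⟨π, rfl⟩
    exact π.isCKFamily.norm_le_one p⟩⟩

/-- `C*(Λ)` as the closure of the `*`-algebra generated by the universal family.  For an element `a`
of the `*`-algebra given by symbols `t_p` and the Cuntz-Krieger relations, the norm of its image in
the direct sum is `sup ‖π(a)‖` over all `*`-representations `π` on Hilbert spaces, so this closure
is the Hausdorff completion of that `*`-algebra in this universal seminorm.  (As `Λ` is countable,
the size of the Hilbert spaces makes no difference.) -/
def cstarSubalgebra : NonUnitalStarSubalgebra ℂ Λ.RepProduct :=
  (NonUnitalStarAlgebra.adjoin ℂ (Set.range Λ.universalFamily)).topologicalClosure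

/-- The C*-algebra `C*(Λ)` of the `k`-graph `Λ`. -/
def CStar : Type (max u v + 1) := Λ.cstarSubalgebra

namespace CStar

instance : NonUnitalCStarAlgebra Λ.CStar :=
  NonUnitalStarSubalgebra.nonUnitalCStarAlgebra Λ.cstarSubalgebra
    (h_closed := NonUnitalStarSubalgebra.isClosed_topologicalClosure _)

/-- The element `t_p` of the universal Cuntz-Krieger family in `C*(Λ)`, where `t_v` is written `q_v`
for the identity path at a vertex `v`. -/
def t (p : Λ.Path) : Λ.CStar :=
  ⟨Λ.universalFamily p, NonUnitalStarSubalgebra.le_topologicalClosure _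
    (NonUnitalStarAlgebra.subset_adjoin ℂ _ ⟨p, rfl⟩)⟩

/-- The linear span `A` of the elements `t_p t_q*`. -/
def spanning : Submodule ℂ Λ.CStar :=
  Submodule.span ℂ {a | ∃ p q : Λ.Path, a = t Λ p * star (t Λ q)}

/-- The linear span `A_n` of the elements `t_p t_q*` with `d(p) - d(q) = n`, for `n ∈ ℤ^k`. -/
def homogeneous (n : Fin k → ℤ) : Submodule ℂ Λ.CStar :=
  Submodule.span ℂ {a | ∃ p q : Λ.Path, (∀ i, (p.deg i : ℤ) - (q.deg i : ℤ) = n i) ∧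
    a = t Λ p * star (t Λ q)}

end CStar

end KGraph

end

/-! The homomorphism exists because a Cuntz-Krieger family in a C*-algebra satisfies the
Kumjian-Pask relations; only (KP3) for distinct paths of equal degree is not immediate, and
positivity gives it (`IsCKFamily.star_mul_eq_zero`). The elements `s_p s_q*` span the Kumjian-Pask
algebra, so the image is `A`, which is then a `*`-subalgebra containing every `t_p` and hence dense.

Injectivity and the grading both come from one representation, on `ℓ²(Λ^∞ × ℤ^k)`: `S_p` sends the
basis vector at `(x, m)` to the one at `(px, m + d(p))` if `r(x) = s(p)`, and to `0` otherwise. The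
factor `ℤ^k` replaces the gauge action: `S_p S_q*` moves the second coordinate by `d(p) - d(q)`, so
different `A_n` have disjoint sets of nonzero matrix coefficients.

For injectivity, (KP4) rewrites any element as a combination of terms `s_p s_q*` with `s(p) = s(q)`
and `d(q) = n` for one common `n`. The operators `S_p S_q*` of such pairs are linearly independent
(`linearIndependent_shift_mul_star_shift`). Take an infinite path `x` with range `s(q)`, which
exists as there are no sources. The coefficient from `(qx, d(q))` to `(px, d(p))` is `1` for the
pair `(p, q)`. A second pair contributing there has the same `q`, the initial segment of degree `n`
of `qx`; then the `ℤ^k` coordinate gives the degree of its first path, which must be `p`. No graded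
uniqueness theorem is needed. -/

noncomputable section

namespace KGraph

variable {k : ℕ} {Λ : KGraph.{u, v} k}

namespace Path

/-! ### Composition of paths and initial segments -/

/-- The underlying morphism of a path. -/
def hom (p : Λ.Path) : p.src ⟶ p.rng := p.2.2

theorem src_mk {a b : Λ.Vertex} (f : a ⟶ b) : (mk f).src = a := rfl

theorem rng_mk {a b : Λ.Vertex} (f : a ⟶ b) : (mk f).rng = b := rfl

theorem mk_injective {a b : Λ.Vertex} {f g : a ⟶ b} (h : mk f = mk g) : f = g := by
  have h' : (⟨b, f⟩ : Σ c, (a ⟶ c)) = ⟨b, g⟩ := eq_of_heq (Sigma.mk.inj h).2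
  exact eq_of_heq (Sigma.mk.inj h').2

open Classical in
/-- The composite `pq` of two paths, with the junk value `p` if `s(p) ≠ r(q)`. -/
def comp (p q : Λ.Path) : Λ.Path :=
  if h : q.rng = p.src then mk (q.hom ≫ eqToHom h ≫ p.hom) else p

theorem comp_mk {a b c : Λ.Vertex} (f : b ⟶ c) (g : a ⟶ b) :
    comp (mk f) (mk g) = mk (g ≫ f) := by
  refine (dif_pos rfl).trans (congrArg mk ?_)
  exact congrArg (g ≫ ·) (Category.id_comp f)

/-- Substituting the common vertex removes the `eqToHom` from composites, so identities between them
reduce to `comp_mk` and the category axioms. -/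
theorem exists_eq_mk_of_rng_eq_src {p q : Λ.Path} (h : q.rng = p.src) :
    ∃ (a b c : Λ.Vertex) (f : b ⟶ c) (g : a ⟶ b), p = mk f ∧ q = mk g := by
  obtain ⟨a, b, f⟩ := p
  obtain ⟨c, d, g⟩ := q
  obtain rfl : d = a := h
  exact ⟨c, d, b, f, g, rfl, rfl⟩

theorem rng_comp (p q : Λ.Path) : (comp p q).rng = p.rng := by
  unfold comp; split_ifs
  · exact rng_mk _
  · rfl

theorem src_comp {p q : Λ.Path} (h : q.rng = p.src) : (comp p q).src = q.src := by
  unfold comp; rw [dif_pos h, src_mk]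

theorem deg_comp {p q : Λ.Path} (h : q.rng = p.src) : (comp p q).deg = p.deg + q.deg := by
  obtain ⟨a, b, c, f, g, rfl, rfl⟩ := exists_eq_mk_of_rng_eq_src h
  rw [comp_mk]
  exact Λ.degree_comp g f

theorem comp_assoc {p q r : Λ.Path} (h : q.rng = p.src) (h' : r.rng = q.src) :
    comp (comp p q) r = comp p (comp q r) := by
  obtain ⟨a, b, f⟩ := p
  obtain ⟨c, d, g⟩ := q
  obtain ⟨c', d', g'⟩ := r
  obtain rfl : d = a := h
  obtain rfl : d' = c := h'
  change comp (comp (mk f) (mk g)) (mk g') = comp (mk f) (comp (mk g) (mk g'))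
  simp [comp_mk]

theorem comp_vert (p : Λ.Path) : comp p (vert p.src) = p := by
  obtain ⟨a, b, f⟩ := p
  change comp (mk f) (mk (𝟙 a)) = mk f
  simp [comp_mk]

theorem vert_comp (p : Λ.Path) : comp (vert p.rng) p = p := by
  obtain ⟨a, b, f⟩ := p
  change comp (mk (𝟙 b)) (mk f) = mk f
  simp [comp_mk]

theorem deg_vert (x : Λ.Vertex) : (vert x).deg = 0 := Λ.degree_id x

theorem src_vert (x : Λ.Vertex) : (vert x).src = x := rfl

theorem exists_comp_eq (p : Λ.Path) {m n : Fin k → ℕ} (h : p.deg = m + n) :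
    ∃ q r : Λ.Path, r.rng = q.src ∧ comp q r = p ∧ q.deg = m ∧ r.deg = n := by
  obtain ⟨a, b, f⟩ := p
  obtain ⟨⟨c, g, g'⟩, ⟨h1, h2, h3⟩, -⟩ := Λ.factorization f m n h
  refine ⟨mk g, mk g', rfl, ?_, h1, h2⟩
  rw [comp_mk]
  exact congrArg mk h3

/-- The uniqueness half of the factorization property; the second degrees agree automatically, by
cancellation in `ℕ^k`. -/
theorem comp_injective {p q p' q' : Λ.Path} (h : q.rng = p.src) (h' : q'.rng = p'.src)
    (hd : p.deg = p'.deg) (he : comp p q = comp p' q') : p = p' ∧ q = q' := by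
  have hd2 : q.deg = q'.deg := by
    have := congrArg deg he
    rw [deg_comp h, deg_comp h', hd] at this
    exact add_left_cancel this
  obtain ⟨a, b, c, f, g, rfl, rfl⟩ := exists_eq_mk_of_rng_eq_src h
  obtain ⟨a', b', c', f', g', rfl, rfl⟩ := exists_eq_mk_of_rng_eq_src h'
  rw [comp_mk, comp_mk] at he
  obtain rfl : a = a' := congrArg src he
  obtain rfl : c = c' := congrArg rng he
  have he' : g ≫ f = g' ≫ f' := mk_injective he
  have := (Λ.factorization (g ≫ f) _ _ (Λ.degree_comp g f)).unique
    (y₁ := ⟨b, f, g⟩) (y₂ := ⟨b', f', g'⟩) ⟨rfl, rfl, rfl⟩ ⟨hd.symm, hd2.symm, he'.symm⟩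
  cases this
  exact ⟨rfl, rfl⟩

/-- Both `p · s(p)` and `r(p) · p` factor `p` with degrees `0 + 0`, so the first factors coincide.
-/
theorem eq_vert_of_deg_eq_zero {p : Λ.Path} (h : p.deg = 0) : p = vert p.rng := by
  refine (comp_injective (p := p) (q := vert p.src) (p' := vert p.rng) (q' := p) rfl rfl ?_ ?_).1
  · rw [h, deg_vert]
  · rw [comp_vert, vert_comp]

theorem src_eq_rng_of_deg_eq_zero {p : Λ.Path} (h : p.deg = 0) : p.src = p.rng := by
  have := congrArg src (eq_vert_of_deg_eq_zero h)
  rwa [src_vert] at this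

/-- `p` is an initial segment of `q`. -/
def IsPrefix (p q : Λ.Path) : Prop := ∃ r : Λ.Path, r.rng = p.src ∧ comp p r = q

theorem isPrefix_comp {p q : Λ.Path} (h : q.rng = p.src) : IsPrefix p (comp p q) := ⟨q, h, rfl⟩

namespace IsPrefix

theorem refl (p : Λ.Path) : IsPrefix p p := ⟨vert p.src, rfl, comp_vert p⟩

theorem trans {p q r : Λ.Path} (h : IsPrefix p q) (h' : IsPrefix q r) : IsPrefix p r := by
  obtain ⟨t, ht, rfl⟩ := h
  obtain ⟨t', ht', rfl⟩ := h'
  rw [src_comp ht] at ht'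
  exact ⟨comp t t', (rng_comp _ _).trans ht, (comp_assoc ht ht').symm⟩

theorem rng_eq {p q : Λ.Path} (h : IsPrefix p q) : p.rng = q.rng := by
  obtain ⟨r, -, rfl⟩ := h
  exact (rng_comp _ _).symm

theorem eq_of_deg_eq {p q r : Λ.Path} (h : IsPrefix p r) (h' : IsPrefix q r)
    (hd : p.deg = q.deg) : p = q := by
  obtain ⟨t, ht, rfl⟩ := h
  obtain ⟨t', ht', he⟩ := h'
  exact (comp_injective ht ht' hd he.symm).1

theorem exists_deg_eq (q : Λ.Path) {n : Fin k → ℕ} (hn : n ≤ q.deg) :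
    ∃ p, IsPrefix p q ∧ p.deg = n := by
  obtain ⟨m, hm⟩ := exists_add_of_le hn
  obtain ⟨p, r, h, he, hp, -⟩ := exists_comp_eq q hm
  exact ⟨p, ⟨r, h, he⟩, hp⟩

/-- The initial segment of `q` of degree `d(p)` is also one of `r`, and `r` has only one of that
degree. -/
theorem of_deg_le {p q r : Λ.Path} (h : IsPrefix p r) (h' : IsPrefix q r)
    (hd : p.deg ≤ q.deg) : IsPrefix p q := by
  obtain ⟨p', hp', hpd⟩ := exists_deg_eq q hd
  rwa [h.eq_of_deg_eq (hp'.trans h') hpd.symm]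

theorem comp_left {p q r : Λ.Path} (h : q.rng = p.src) (h' : IsPrefix q r) :
    IsPrefix (comp p q) (comp p r) := by
  obtain ⟨t, ht, rfl⟩ := h'
  rw [← comp_assoc h ht]
  exact isPrefix_comp (by rw [src_comp h, ht])

theorem of_comp_left {p q r : Λ.Path} (hq : q.rng = p.src) (hr : r.rng = p.src)
    (h : IsPrefix (comp p q) (comp p r)) : IsPrefix q r := by
  obtain ⟨t, ht, he⟩ := h
  rw [src_comp hq] at ht
  rw [comp_assoc hq ht] at he
  exact ⟨t, ht, (comp_injective ((rng_comp _ _).trans hq) hr rfl he).2⟩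

end IsPrefix

open Classical in
/-- The initial segment of degree `n` of `q`, with a junk value unless `n ≤ d(q)`. -/
def pre (q : Λ.Path) (n : Fin k → ℕ) : Λ.Path :=
  if h : n ≤ q.deg then (IsPrefix.exists_deg_eq q h).choose else q

theorem isPrefix_pre {q : Λ.Path} {n : Fin k → ℕ} (h : n ≤ q.deg) : IsPrefix (q.pre n) q := by
  unfold pre; rw [dif_pos h]; exact (IsPrefix.exists_deg_eq q h).choose_spec.1

theorem deg_pre {q : Λ.Path} {n : Fin k → ℕ} (h : n ≤ q.deg) : (q.pre n).deg = n := by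
  unfold pre; rw [dif_pos h]; exact (IsPrefix.exists_deg_eq q h).choose_spec.2

end Path

open KGraph.Path

/-! ### Infinite paths -/

/-- An infinite path, given by its initial segments of all degrees. -/
@[ext]
structure InfPath (Λ : KGraph.{u, v} k) : Type (max u v) where
  seg : (Fin k → ℕ) → Λ.Path
  deg_seg : ∀ n, (seg n).deg = n
  isPrefix_seg : ∀ {m n}, m ≤ n → IsPrefix (seg m) (seg n)

namespace InfPath

/-- The range of an infinite path. -/
def rng (x : Λ.InfPath) : Λ.Vertex := (x.seg 0).rng

theorem rng_seg (x : Λ.InfPath) (n : Fin k → ℕ) : (x.seg n).rng = x.rng :=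
  (x.isPrefix_seg (zero_le : 0 ≤ n)).rng_eq.symm

/-- The infinite path `px`, for `s(p) = r(x)`. -/
def cons (p : Λ.Path) (x : Λ.InfPath) (h : x.rng = p.src) : Λ.InfPath where
  -- `p x(n)` has degree `d(p) + n ≥ n`, so cutting it at `n` covers all degrees, including those
  -- not above `d(p)`.
  seg n := (comp p (x.seg n)).pre n
  deg_seg n := deg_pre (by
    rw [deg_comp ((x.rng_seg n).trans h), x.deg_seg]; exact le_add_self)
  isPrefix_seg {m n} hmn := by
    have key : ∀ n, n ≤ (comp p (x.seg n)).deg := fun n => by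
      rw [deg_comp ((x.rng_seg n).trans h), x.deg_seg]; exact le_add_self
    refine IsPrefix.of_deg_le (r := comp p (x.seg n)) ?_ (isPrefix_pre (key n)) ?_
    · exact (isPrefix_pre (key m)).trans
        ((x.isPrefix_seg hmn).comp_left ((x.rng_seg m).trans h))
    · rwa [deg_pre (key m), deg_pre (key n)]

/-- Both sides are initial segments of `p x(d(p) + n)` of the same degree. These degrees are
cofinal, so this formula determines `px`. -/
theorem seg_cons_add (p : Λ.Path) (x : Λ.InfPath) (h : x.rng = p.src) (n : Fin k → ℕ) :
    (cons p x h).seg (p.deg + n) = comp p (x.seg n) := by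
  have h1 : ∀ n, (x.seg n).rng = p.src := fun n => (x.rng_seg n).trans h
  have h2 : (comp p (x.seg (p.deg + n))).deg = p.deg + (p.deg + n) := by
    rw [deg_comp (h1 _), x.deg_seg]
  have h3 : p.deg + n ≤ (comp p (x.seg (p.deg + n))).deg := by rw [h2]; exact le_add_self
  refine (isPrefix_pre h3).eq_of_deg_eq
    ((x.isPrefix_seg (le_add_self : n ≤ p.deg + n)).comp_left (h1 n)) ?_
  rw [deg_pre h3, deg_comp (h1 n), x.deg_seg]

theorem seg_cons_deg (p : Λ.Path) (x : Λ.InfPath) (h : x.rng = p.src) :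
    (cons p x h).seg p.deg = p := by
  have := seg_cons_add p x h 0
  rw [add_zero] at this
  rw [this]
  have h0 := eq_vert_of_deg_eq_zero (x.deg_seg 0)
  rw [h0, x.rng_seg, h, comp_vert]

theorem rng_cons (p : Λ.Path) (x : Λ.InfPath) (h : x.rng = p.src) : (cons p x h).rng = p.rng := by
  rw [← (cons p x h).rng_seg p.deg, seg_cons_deg]

/-- Two infinite paths agree if their initial segments agree in a cofinal set of degrees. -/
theorem ext_of_add {x y : Λ.InfPath} (m : Fin k → ℕ) (h : ∀ n, x.seg (m + n) = y.seg (m + n)) :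
    x = y := by
  ext1
  funext n
  refine (x.isPrefix_seg (le_add_self : n ≤ m + n)).eq_of_deg_eq (r := x.seg (m + n)) ?_ ?_
  · rw [h]; exact y.isPrefix_seg le_add_self
  · rw [x.deg_seg, y.deg_seg]

theorem cons_injective {p : Λ.Path} {x y : Λ.InfPath} {hx : x.rng = p.src} {hy : y.rng = p.src}
    (h : cons p x hx = cons p y hy) : x = y := by
  refine ext_of_add 0 fun n => ?_
  have := congrArg (fun z => InfPath.seg z (p.deg + (0 + n))) h
  simp only [seg_cons_add] at this
  exact (comp_injective ((x.rng_seg _).trans hx) ((y.rng_seg _).trans hy) rfl this).2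

theorem cons_comp {p q : Λ.Path} (h : q.rng = p.src) (x : Λ.InfPath) (hx : x.rng = q.src) :
    cons (comp p q) x (hx.trans (src_comp h).symm) =
      cons p (cons q x hx) ((rng_cons q x hx).trans h) := by
  refine ext_of_add (comp p q).deg fun n => ?_
  rw [seg_cons_add, deg_comp h, add_assoc, seg_cons_add, seg_cons_add,
    comp_assoc h ((x.rng_seg n).trans hx)]

/-- The remainders `r n` of the segments `y(d(p) + n)` after removing `p` are coherent by left
cancellation, so they form an infinite path. -/
theorem exists_cons_eq {p : Λ.Path} {y : Λ.InfPath} (h : y.seg p.deg = p) :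
    ∃ (x : Λ.InfPath) (hx : x.rng = p.src), cons p x hx = y := by
  have h1 : ∀ n, ∃ r : Λ.Path, r.rng = p.src ∧ comp p r = y.seg (p.deg + n) := fun n => by
    have := y.isPrefix_seg (le_self_add : p.deg ≤ p.deg + n)
    rwa [h] at this
  choose r hr hc using h1
  have hd : ∀ n, (r n).deg = n := fun n => by
    have := congrArg deg (hc n)
    rw [deg_comp (hr n), y.deg_seg] at this
    exact add_left_cancel this
  let x : Λ.InfPath :=
    { seg := r
      deg_seg := hd
      isPrefix_seg := fun {m n} hmn => by
        refine IsPrefix.of_comp_left (hr m) (hr n) ?_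
        rw [hc, hc]
        exact y.isPrefix_seg (add_le_add_right hmn _) }
  refine ⟨x, hr 0, ext_of_add p.deg fun n => ?_⟩
  exact (seg_cons_add p x (hr 0) n).trans (hc n)

/-- Appending paths of degree `(1, …, 1)` again and again gives segments of degree `(j, …, j)`,
which are cofinal in `ℕ^k`. -/
theorem exists_rng_eq (hsrc : Λ.NoSources) (a : Λ.Vertex) : ∃ x : Λ.InfPath, x.rng = a := by
  have hs : ∀ b : Λ.Vertex, ∃ q : Λ.Path, q.rng = b ∧ q.deg = 1 := fun b => hsrc b 1
  choose q hq hqd using hs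
  let l : ℕ → Λ.Path := fun j => Nat.rec (vert a) (fun _ p => comp p (q p.src)) j
  have hl : ∀ j, l (j + 1) = comp (l j) (q (l j).src) := fun j => rfl
  have hd : ∀ j, (l j).deg = fun _ => j := fun j => by
    induction j with
    | zero => exact deg_vert a
    | succ j ih => rw [hl, deg_comp (hq _), ih, hqd]; rfl
  have hpre : ∀ {i j}, i ≤ j → IsPrefix (l i) (l j) := fun {i j} hij => by
    induction hij with
    | refl => exact IsPrefix.refl _
    | step _ ih => exact ih.trans (hl _ ▸ isPrefix_comp (hq _))
  -- The coordinate sum is a convenient bound for all coordinates of `n` that is monotone in `n`.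
  have hle : ∀ n : Fin k → ℕ, n ≤ (l (∑ i, n i)).deg := fun n i => by
    rw [hd]; exact Finset.single_le_sum (f := n) (fun _ _ => Nat.zero_le _) (Finset.mem_univ i)
  let x : Λ.InfPath :=
    { seg := fun n => (l (∑ i, n i)).pre n
      deg_seg := fun n => deg_pre (hle n)
      isPrefix_seg := fun {m n} hmn => by
        refine IsPrefix.of_deg_le (r := l (∑ i, n i)) ?_ (isPrefix_pre (hle n)) ?_
        · exact (isPrefix_pre (hle m)).trans (hpre (Finset.sum_le_sum fun i _ => hmn i))
        · rwa [deg_pre (hle m), deg_pre (hle n)] }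
  refine ⟨x, ?_⟩
  have h1 : IsPrefix (x.seg 0) (l (∑ i : Fin k, (0 : Fin k → ℕ) i)) := isPrefix_pre (hle 0)
  have h2 : IsPrefix (l 0) (l (∑ i : Fin k, (0 : Fin k → ℕ) i)) := hpre (Nat.zero_le _)
  exact h1.rng_eq.trans h2.rng_eq.symm

end InfPath

end KGraph

end

noncomputable section

/-! ### Partial isometries of `ℓ²` given by partial bijections -/

namespace PEquiv

variable {ι : Type*} (f g : ι ≃. ι)

/-- Up to zero terms, the sum is one of `h` over the finite set of preimages of `s` under `f`; this
makes `lpMap` a contraction. -/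
theorem sum_elim_symm_le {h : ι → ℝ} {C : ℝ}
    (hC : ∀ s : Finset ι, ∑ i ∈ s, h i ≤ C) (s : Finset ι) :
    ∑ i ∈ s, (f.symm i).elim 0 h ≤ C := by
  classical
  have key : ∑ i ∈ s, (f.symm i).elim 0 h =
      ∑ j ∈ s.filterMap f.symm (fun a b c ha hb => f.symm.inj ha hb), h j := by
    symm
    -- The default value is never used: `f` is defined at every `j` in the index set.
    refine Finset.sum_bij_ne_zero (fun j hj _ => (f j).getD j) ?_ ?_ ?_ ?_
    · intro j hj _
      obtain ⟨i, hi, hij⟩ := (Finset.mem_filterMap _).mp hj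
      rw [(f.eq_some_iff).mp hij]
      exact hi
    · intro j hj _ j' hj' _ he
      obtain ⟨i, hi, hij⟩ := (Finset.mem_filterMap _).mp hj
      obtain ⟨i', hi', hij'⟩ := (Finset.mem_filterMap _).mp hj'
      rw [(f.eq_some_iff).mp hij, (f.eq_some_iff).mp hij'] at he
      obtain rfl : i = i' := he
      exact Option.some_injective _ (hij.symm.trans hij')
    · intro i hi hne
      cases hij : f.symm i with
      | none => simp [hij] at hne
      | some j =>
        refine ⟨j, (Finset.mem_filterMap _).mpr ⟨i, hi, hij⟩, by simpa [hij] using hne, ?_⟩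
        rw [(f.eq_some_iff).mp hij]; rfl
    · intro j hj _
      obtain ⟨i, hi, hij⟩ := (Finset.mem_filterMap _).mp hj
      rw [(f.eq_some_iff).mp hij, Option.getD_some, hij]; rfl
  rw [key]
  exact hC _

theorem norm_elim (o : Option ι) (ξ : ι → ℂ) :
    ‖o.elim 0 ξ‖ ^ (2 : ℝ≥0∞).toReal = o.elim 0 fun i => ‖ξ i‖ ^ (2 : ℝ≥0∞).toReal := by
  cases o <;> simp

theorem sum_norm_elim_le (ξ : lp (fun _ : ι => ℂ) 2) (s : Finset ι) :
    ∑ i ∈ s, ‖(f.symm i).elim 0 ξ‖ ^ (2 : ℝ≥0∞).toReal ≤ ‖ξ‖ ^ (2 : ℝ≥0∞).toReal := by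
  simp_rw [norm_elim]
  exact f.sum_elim_symm_le (lp.sum_rpow_le_norm_rpow (by simp) ξ) s

/-- The partial isometry of `ℓ²` that maps the basis vector at `i` to the basis vector at `f i`, or
to `0` if `f i` is undefined. -/
def lpMap : lp (fun _ : ι => ℂ) 2 →L[ℂ] lp (fun _ : ι => ℂ) 2 :=
  LinearMap.mkContinuous
    { toFun := fun ξ => ⟨fun i => (f.symm i).elim 0 ξ, memℓp_gen' (f.sum_norm_elim_le ξ)⟩
      map_add' := fun ξ η => by
        ext i
        change (f.symm i).elim 0 (fun j => ξ j + η j) =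
          (f.symm i).elim 0 (fun j => ξ j) + (f.symm i).elim 0 (fun j => η j)
        cases f.symm i <;> simp
      map_smul' := fun c ξ => by
        ext i
        change (f.symm i).elim 0 (fun j => c * ξ j) = c * (f.symm i).elim 0 (fun j => ξ j)
        cases f.symm i <;> simp } 1 fun ξ => by
    rw [one_mul]
    exact lp.norm_le_of_forall_sum_le (by simp) (norm_nonneg _) (f.sum_norm_elim_le ξ)

theorem lpMap_apply (ξ : lp (fun _ : ι => ℂ) 2) (i : ι) : f.lpMap ξ i = (f.symm i).elim 0 ξ := rfl

theorem lpMap_trans : (f.trans g).lpMap = g.lpMap * f.lpMap := by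
  ext ξ i
  rw [mul_apply_eq_comp, lpMap_apply, lpMap_apply, symm_trans_rev]
  change ((g.symm i).bind f.symm).elim 0 ξ = _
  cases g.symm i with
  | none => rfl
  | some j => rfl

theorem lpMap_ofSet_apply (s : Set ι) [DecidablePred (· ∈ s)] (ξ : lp (fun _ : ι => ℂ) 2) (i : ι) :
    (ofSet s).lpMap ξ i = if i ∈ s then ξ i else 0 := by
  rw [lpMap_apply, ofSet_symm]
  change (if i ∈ s then some i else none).elim 0 ξ = _
  split_ifs <;> rfl

variable [DecidableEq ι]

theorem lpMap_single {i j : ι} (h : f i = some j) (c : ℂ) :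
    f.lpMap (lp.single 2 i c) = lp.single 2 j c := by
  ext l
  rw [lpMap_apply]
  by_cases hl : l = j
  · subst hl
    rw [f.eq_some_iff.mpr h, Option.elim_some, lp.single_apply_self, lp.single_apply_self]
  · rw [lp.single_apply_ne _ _ _ hl]
    cases h' : f.symm l with
    | none => rfl
    | some m =>
      rw [Option.elim_some, lp.single_apply_ne]
      rintro rfl
      rw [f.eq_some_iff, h] at h'
      exact hl (Option.some_injective _ h').symm

theorem lpMap_single_of_eq_none {i : ι} (h : f i = none) (c : ℂ) :
    f.lpMap (lp.single 2 i c) = 0 := by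
  ext l
  rw [lpMap_apply]
  cases h' : f.symm l with
  | none => rfl
  | some m =>
    rw [Option.elim_some, lp.single_apply_ne]
    · rfl
    rintro rfl
    rw [f.eq_some_iff, h] at h'
    cases h'

/-- The coordinate at `i` of the adjoint applied to `ξ` is the inner product of `ξ` with the image
of the basis vector at `i`, which is a basis vector or `0`. -/
theorem star_lpMap : star f.lpMap = f.symm.lpMap := by
  ext ξ i
  have h := lp.inner_single_left (𝕜 := ℂ) i (1 : ℂ) (star f.lpMap ξ)
  rw [ContinuousLinearMap.star_eq_adjoint, ContinuousLinearMap.adjoint_inner_right] at h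
  rw [lpMap_apply, symm_symm]
  have h1 : ∀ z : ℂ, inner ℂ (1 : ℂ) z = z := fun z => by simp
  rw [h1] at h
  rw [ContinuousLinearMap.star_eq_adjoint, ← h]
  cases hi : f i with
  | none => rw [f.lpMap_single_of_eq_none hi, inner_zero_left]; rfl
  | some j => rw [f.lpMap_single hi, lp.inner_single_left, h1]; rfl

end PEquiv

namespace KGraph

open KGraph.Path

variable {k : ℕ} {Λ : KGraph.{u, v} k}

/-! ### The infinite path representation, twisted by the degree -/

namespace Path

/-- The degree as a vector of integers. -/
def degZ (p : Λ.Path) : Fin k → ℤ := fun i => (p.deg i : ℤ)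

theorem degZ_comp {p q : Λ.Path} (h : q.rng = p.src) : (comp p q).degZ = p.degZ + q.degZ := by
  funext i
  simp [degZ, deg_comp h]

theorem degZ_vert (x : Λ.Vertex) : (vert x).degZ = 0 := by
  funext i
  simp [degZ, deg_vert]

theorem degZ_injective {p q : Λ.Path} (h : p.degZ = q.degZ) : p.deg = q.deg := by
  funext i
  exact Int.ofNat_injective (congrFun h i)

end Path

open Classical in
/-- Concatenation with `p` as a partial bijection of `Λ^∞ × ℤ^k`. -/
def shift (p : Λ.Path) : (Λ.InfPath × (Fin k → ℤ)) ≃. (Λ.InfPath × (Fin k → ℤ)) where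
  toFun a := if h : a.1.rng = p.src then some (InfPath.cons p a.1 h, a.2 + p.degZ) else none
  -- The inverse strips `p`; it is defined exactly on the infinite paths that begin with `p`.
  invFun b := if h : b.1.seg p.deg = p then
    some ((InfPath.exists_cons_eq h).choose, b.2 - p.degZ) else none
  inv := by
    rintro ⟨x, m⟩ ⟨y, n⟩
    dsimp only
    split_ifs with h h' h'
    · obtain ⟨hx, hc⟩ := (InfPath.exists_cons_eq h).choose_spec
      simp only [Option.some.injEq, Prod.mk.injEq]
      refine and_congr ⟨?_, ?_⟩ ⟨?_, ?_⟩
      · rintro rfl; exact hc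
      · intro h2; exact InfPath.cons_injective (hc.trans h2.symm)
      · rintro rfl; simp
      · rintro rfl; simp
    · obtain ⟨hx, hc⟩ := (InfPath.exists_cons_eq h).choose_spec
      simp only [Option.some.injEq, Prod.mk.injEq, iff_false]
      rintro ⟨rfl, -⟩
      exact h' hx
    · simp only [Option.some.injEq, Prod.mk.injEq, false_iff]
      rintro ⟨rfl, -⟩
      exact h (InfPath.seg_cons_deg _ _ _)
    · simp

theorem shift_apply (p : Λ.Path) {x : Λ.InfPath} (h : x.rng = p.src) (m : Fin k → ℤ) :
    shift p (x, m) = some (InfPath.cons p x h, m + p.degZ) := dif_pos h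

theorem shift_apply_of_ne (p : Λ.Path) {x : Λ.InfPath} (h : x.rng ≠ p.src) (m : Fin k → ℤ) :
    shift p (x, m) = none := dif_neg h

theorem isSome_shift (p : Λ.Path) (a) : (shift p a).isSome ↔ a.1.rng = p.src := by
  obtain ⟨x, m⟩ := a
  by_cases h : x.rng = p.src
  · simp [shift_apply p h, h]
  · simp [shift_apply_of_ne p h, h]

theorem isSome_shift_symm (p : Λ.Path) (a) :
    ((shift p).symm a).isSome ↔ a.1.seg p.deg = p := by
  classical
  change (dite (a.1.seg p.deg = p) _ _ : Option _).isSome = true ↔ _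
  split_ifs with h
  · simp [h]
  · simp [h]

theorem shift_comp {p q : Λ.Path} (h : q.rng = p.src) :
    shift (comp p q) = (shift q).trans (shift p) := by
  ext1 ⟨x, m⟩
  change _ = (shift q (x, m)).bind (shift p)
  by_cases hx : x.rng = q.src
  · rw [shift_apply _ (hx.trans (src_comp h).symm), shift_apply _ hx, Option.bind_some,
      shift_apply _ ((InfPath.rng_cons q x hx).trans h), InfPath.cons_comp h x hx, degZ_comp h,
      add_comm p.degZ, add_assoc]
  · rw [shift_apply_of_ne _ hx, shift_apply_of_ne]
    · rfl
    · rwa [src_comp h]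

open Classical in
theorem shift_vert (a : Λ.Vertex) :
    shift (vert a) = PEquiv.ofSet {b : Λ.InfPath × (Fin k → ℤ) | b.1.rng = a} := by
  ext1 ⟨x, m⟩
  change _ = if x.rng = a then some (x, m) else none
  split_ifs with h
  · rw [shift_apply _ h, degZ_vert, add_zero]
    refine congrArg some (Prod.ext (InfPath.ext_of_add (vert a).deg fun n => ?_) rfl)
    change (InfPath.cons (vert a) x h).seg _ = x.seg _
    rw [InfPath.seg_cons_add (vert a) x h, deg_vert, zero_add]
    have := vert_comp (x.seg n)
    rwa [x.rng_seg, h] at this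
  · exact shift_apply_of_ne _ h m

open Classical in
/-- The Cuntz-Krieger family on `ℓ²(Λ^∞ × ℤ^k)`. -/
theorem isCKFamily_lpMap_shift (hfin : Λ.RowFinite) :
    Λ.IsCKFamily (fun p : Λ.Path => (shift p).lpMap) := by
  have hcomp : ∀ {p q : Λ.Path}, q.rng = p.src →
      (shift p).lpMap * (shift q).lpMap = (shift (comp p q)).lpMap := fun h => by
    rw [shift_comp h, PEquiv.lpMap_trans]
  have hself : ∀ p : Λ.Path, star (shift p).lpMap * (shift p).lpMap =
      (shift (vert p.src)).lpMap := fun p => by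
    rw [PEquiv.star_lpMap, ← PEquiv.lpMap_trans, PEquiv.self_trans_symm, shift_vert]
    congr! with a
    exact isSome_shift p a
  refine ⟨fun p => ?_, fun a => ?_, fun a => ?_, fun a b hab => ?_, fun f g => ?_, hself,
    fun a n => ?_⟩
  · rw [mul_assoc, hself, hcomp rfl, comp_vert]
  · rw [PEquiv.star_lpMap, shift_vert, PEquiv.ofSet_symm]
  · rw [hcomp rfl]
    exact congrArg (fun p => (shift p).lpMap) (comp_vert (vert a))
  · rw [← PEquiv.lpMap_trans, shift_vert, shift_vert]
    ext ξ i
    rw [PEquiv.lpMap_trans, mul_apply_eq_comp, PEquiv.lpMap_ofSet_apply,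
      PEquiv.lpMap_ofSet_apply]
    split_ifs with h1 h2
    · exact absurd (h1.symm.trans h2) hab
    · rfl
    · rfl
  · rw [hcomp rfl, comp_mk]
  · have := (hfin a n).to_subtype
    have := Fintype.ofFinite (Λ.pathsTo a n)
    rw [finsum_eq_sum_of_fintype]
    have hp : ∀ p : Λ.Path, (shift p).lpMap * star (shift p).lpMap =
        (PEquiv.ofSet {b : Λ.InfPath × (Fin k → ℤ) | b.1.seg p.deg = p}).lpMap := fun p => by
      rw [PEquiv.star_lpMap, ← PEquiv.lpMap_trans, PEquiv.symm_trans_self]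
      congr! with a
      exact isSome_shift_symm p a
    simp_rw [hp]
    ext ξ i
    rw [shift_vert, PEquiv.lpMap_ofSet_apply, sum_apply, lp.coeFn_sum,
      Finset.sum_apply]
    simp_rw [PEquiv.lpMap_ofSet_apply]
    -- An infinite path with range `a` begins with exactly one path of degree `n`, so one projection
    -- in the sum acts as the identity at `i` and the others vanish there; for any other range all
    -- vanish.
    by_cases hi : i.1.rng = a
    · rw [if_pos (show i ∈ {b : Λ.InfPath × (Fin k → ℤ) | b.1.rng = a} from hi),
        Finset.sum_eq_single (⟨i.1.seg n, (i.1.rng_seg n).trans hi, i.1.deg_seg n⟩ :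
          Λ.pathsTo a n)]
      · rw [if_pos]
        change i.1.seg (i.1.seg n).deg = i.1.seg n
        rw [i.1.deg_seg]
      · rintro ⟨p, hpr, hpd⟩ - hne
        rw [if_neg]
        intro hs
        refine hne (Subtype.ext ?_)
        have hs' : i.1.seg p.deg = p := hs
        rw [hpd] at hs'
        exact hs'.symm
      · simp
    · rw [if_neg (show i ∉ {b : Λ.InfPath × (Fin k → ℤ) | b.1.rng = a} from hi),
        Finset.sum_eq_zero]
      rintro ⟨p, hpr, hpd⟩ -
      rw [if_neg]
      intro hs
      refine hi ?_
      rw [← hpr, ← i.1.rng_seg p.deg]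
      exact congrArg rng hs

end KGraph

end

noncomputable section

namespace KGraph

open KGraph.Path

variable {k : ℕ} {Λ : KGraph.{u, v} k}

/-! ### The universal Cuntz-Krieger family -/

/-- The component of an element of the product at a representation. -/
def RepProduct.eval (ρ : Λ.CKRep) : Λ.RepProduct →⋆ₙₐ[ℂ] (ρ.H →L[ℂ] ρ.H) where
  toFun a := a.1 ρ
  map_smul' _ _ := rfl
  map_zero' := rfl
  map_add' _ _ := rfl
  map_mul' _ _ := rfl
  map_star' _ := rfl

namespace CStar

/-- The representation of `C*(Λ)` that belongs to a Cuntz-Krieger family. -/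
def eval (ρ : Λ.CKRep) : Λ.CStar →⋆ₙₐ[ℂ] (ρ.H →L[ℂ] ρ.H) where
  toFun a := RepProduct.eval ρ a.1
  map_smul' _ _ := rfl
  map_zero' := rfl
  map_add' _ _ := rfl
  map_mul' _ _ := rfl
  map_star' _ := rfl

theorem eval_t (ρ : Λ.CKRep) (p : Λ.Path) : eval ρ (t Λ p) = ρ.S p := rfl

/-- `C*(Λ)` lies in a product indexed by the representations, so its relations can be checked in
each one. -/
theorem ext_eval {a b : Λ.CStar} (h : ∀ ρ : Λ.CKRep, eval ρ a = eval ρ b) : a = b :=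
  Subtype.ext (Subtype.ext (funext h))

theorem isCKFamily_t (hfin : Λ.RowFinite) : Λ.IsCKFamily (t Λ) := by
  refine ⟨fun p => ?_, fun a => ?_, fun a => ?_, fun a b hab => ?_, fun f g => ?_, fun p => ?_,
    fun a n => ?_⟩ <;> refine ext_eval fun ρ => ?_
  · simp only [map_mul, map_star, eval_t, ρ.isCKFamily.partial_isometry]
  · simp only [map_star, eval_t, ρ.isCKFamily.vert_star]
  · simp only [map_mul, eval_t, ρ.isCKFamily.vert_idem]
  · simp only [map_mul, eval_t, map_zero, ρ.isCKFamily.vert_orthogonal a b hab]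
  · simp only [map_mul, eval_t, ρ.isCKFamily.comp]
  · simp only [map_mul, map_star, eval_t, ρ.isCKFamily.star_mul_self]
  · have := (hfin a n).to_subtype
    have := Fintype.ofFinite (Λ.pathsTo a n)
    have h := ρ.isCKFamily.sum_range a n
    rw [finsum_eq_sum_of_fintype] at h ⊢
    simp only [map_sum, map_mul, map_star, eval_t]
    exact h

end CStar

namespace IsCKFamily

section

variable {A : Type w} [NonUnitalRing A] [StarRing A] {S : Λ.Path → A}

theorem mul_vert_src (hS : Λ.IsCKFamily S) (p : Λ.Path) : S p * S (vert p.src) = S p := by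
  rw [← hS.star_mul_self, ← mul_assoc, hS.partial_isometry]

theorem vert_rng_mul (hS : Λ.IsCKFamily S) (p : Λ.Path) : S (vert p.rng) * S p = S p := by
  obtain ⟨a, b, f⟩ := p
  have := hS.comp (𝟙 b) f
  rwa [Category.comp_id] at this

theorem star_mul_vert_rng (hS : Λ.IsCKFamily S) (p : Λ.Path) :
    star (S p) * S (vert p.rng) = star (S p) := by
  conv_rhs => rw [← hS.vert_rng_mul p, star_mul, hS.vert_star]

theorem vert_src_mul_star (hS : Λ.IsCKFamily S) (p : Λ.Path) : S (vert p.src) * star (S p) = star (S p) := by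
  conv_rhs => rw [← hS.mul_vert_src p, star_mul, hS.vert_star]

end

/-- If the ranges agree, summing `(S_p* S_r)(S_p* S_r)*` over all `r` of the range and degree of `p`
gives `S_p* S_p`. The term `r = p` alone already equals this, so the other terms, being positive
with sum `0`, vanish. If the ranges differ, the vertex projections are orthogonal. -/
theorem star_mul_eq_zero {A : Type w} [NonUnitalCStarAlgebra A] {S : Λ.Path → A}
    (hfin : Λ.RowFinite) (hS : Λ.IsCKFamily S) {p q : Λ.Path} (hd : p.deg = q.deg) (hne : p ≠ q) :
    star (S p) * S q = 0 := by
  classical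
  by_cases hr : p.rng = q.rng
  · let _ := CStarAlgebra.spectralOrder A
    let _ := CStarAlgebra.spectralOrderedRing A
    have hpp : star (S p) * S p * star (S p) = star (S p) := by
      simpa [mul_assoc] using congrArg star (hS.partial_isometry p)
    have := (hfin p.rng p.deg).to_subtype
    have := Fintype.ofFinite (Λ.pathsTo p.rng p.deg)
    have hsum := hS.sum_range p.rng p.deg
    rw [finsum_eq_sum_of_fintype] at hsum
    let a : Λ.pathsTo p.rng p.deg → A := fun r => star (S p) * S r.1
    have ha : ∑ r, a r * star (a r) = star (S p) * S p := by
      simp only [a, star_mul, star_star]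
      simp_rw [mul_assoc, ← mul_assoc (S _) (star (S _)) (S p)]
      rw [← Finset.mul_sum, ← Finset.sum_mul, ← hsum, hS.vert_rng_mul]
    let p' : Λ.pathsTo p.rng p.deg := ⟨p, rfl, rfl⟩
    let q' : Λ.pathsTo p.rng p.deg := ⟨q, hr.symm, hd.symm⟩
    have hap : a p' * star (a p') = star (S p) * S p := by
      simp only [a, p', star_mul, star_star]
      rw [← mul_assoc, hpp]
    rw [← Finset.add_sum_erase _ _ (Finset.mem_univ p'), hap, add_eq_left,
      Finset.sum_eq_zero_iff_of_nonneg fun r _ => mul_star_self_nonneg _] at ha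
    have hq := ha q' (Finset.mem_erase.mpr
      ⟨fun h => hne (congrArg Subtype.val h).symm, Finset.mem_univ _⟩)
    exact CStarRing.mul_star_self_eq_zero_iff _ |>.mp hq
  · rw [← hS.star_mul_vert_rng p, ← hS.vert_rng_mul q, mul_assoc, ← mul_assoc (S (vert _)),
      hS.vert_orthogonal _ _ hr, zero_mul, mul_zero]

end IsCKFamily

/-! ### Relations in the Kumjian-Pask algebra -/

namespace KP

section Relations

variable {R : Type w} [CommRing R]

theorem mk_eq_zero {x : Λ.FreeAlg R} (h : Λ.KPRelator R x) : mk Λ R x = 0 := by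
  have hx : x ∈ Λ.kpIdeal R := by
    rw [kpIdeal, TwoSidedIdeal.mem_sInf]
    exact fun I hI => hI.2 x h
  exact Quotient.sound hx

theorem s_vert (a : Λ.Vertex) : s Λ R (vert a) = mk Λ R (FreeAlg.ι Λ R (.vertex a)) :=
  dif_pos (deg_vert a)

theorem s_of_deg_ne_zero {p : Λ.Path} (hp : p.deg ≠ 0) :
    s Λ R p = mk Λ R (FreeAlg.ι Λ R (.path p hp)) := dif_neg hp

theorem sGhost_vert (a : Λ.Vertex) : sGhost Λ R (vert a) = mk Λ R (FreeAlg.ι Λ R (.vertex a)) :=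
  dif_pos (deg_vert a)

theorem sGhost_of_deg_ne_zero {p : Λ.Path} (hp : p.deg ≠ 0) :
    sGhost Λ R p = mk Λ R (FreeAlg.ι Λ R (.ghost p hp)) := dif_neg hp

theorem vert_mul_vert (a : Λ.Vertex) : s Λ R (vert a) * s Λ R (vert a) = s Λ R (vert a) := by
  rw [s_vert, ← map_mul, ← sub_eq_zero, ← map_sub]
  exact mk_eq_zero (.kp1_same a)

theorem vert_mul_vert_of_ne {a b : Λ.Vertex} (h : a ≠ b) :
    s Λ R (vert a) * s Λ R (vert b) = 0 := by
  rw [s_vert, s_vert, ← map_mul]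
  exact mk_eq_zero (.kp1_ne a b h)

theorem vert_rng_mul (p : Λ.Path) : s Λ R (vert p.rng) * s Λ R p = s Λ R p := by
  by_cases hp : p.deg = 0
  · rw [eq_vert_of_deg_eq_zero hp]
    exact vert_mul_vert _
  · rw [s_vert, s_of_deg_ne_zero hp, ← map_mul, ← sub_eq_zero, ← map_sub]
    exact mk_eq_zero (.kp2_rng_path p hp)

theorem mul_vert_src (p : Λ.Path) : s Λ R p * s Λ R (vert p.src) = s Λ R p := by
  by_cases hp : p.deg = 0
  · rw [eq_vert_of_deg_eq_zero hp]
    exact vert_mul_vert _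
  · rw [s_vert, s_of_deg_ne_zero hp, ← map_mul, ← sub_eq_zero, ← map_sub]
    exact mk_eq_zero (.kp2_path_src p hp)

theorem s_mul_s {p q : Λ.Path} (h : q.rng = p.src) : s Λ R p * s Λ R q = s Λ R (comp p q) := by
  by_cases hp : p.deg = 0
  · have h' := h.trans (src_eq_rng_of_deg_eq_zero hp)
    rw [eq_vert_of_deg_eq_zero hp, ← h', vert_rng_mul, vert_comp]
  by_cases hq : q.deg = 0
  · rw [eq_vert_of_deg_eq_zero hq, h, mul_vert_src, comp_vert]
  obtain ⟨a, b, c, f, g, rfl, rfl⟩ := exists_eq_mk_of_rng_eq_src h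
  rw [comp_mk, s_of_deg_ne_zero hp, s_of_deg_ne_zero hq, s_of_deg_ne_zero (deg_comp_ne_zero hp),
    ← map_mul, ← sub_eq_zero, ← map_sub]
  exact mk_eq_zero (.kp2_path f g hp hq)

theorem s_mul_s_of_ne {p q : Λ.Path} (h : q.rng ≠ p.src) : s Λ R p * s Λ R q = 0 := by
  rw [← mul_vert_src p, ← vert_rng_mul q, mul_assoc, ← mul_assoc (s Λ R (vert _)),
    vert_mul_vert_of_ne h.symm, zero_mul, mul_zero]

variable [StarRing R]

theorem star_s (p : Λ.Path) : star (s Λ R p) = sGhost Λ R p := by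
  by_cases hp : p.deg = 0
  · rw [eq_vert_of_deg_eq_zero hp, s_vert, sGhost_vert, ← mk_star, FreeAlg.star_ι]
    rfl
  · rw [s_of_deg_ne_zero hp, sGhost_of_deg_ne_zero hp, ← mk_star, FreeAlg.star_ι]
    rfl

theorem star_vert (a : Λ.Vertex) : star (s Λ R (vert a)) = s Λ R (vert a) := by
  rw [star_s, s_vert, sGhost_vert]

theorem star_s_mul_s_self (p : Λ.Path) : star (s Λ R p) * s Λ R p = s Λ R (vert p.src) := by
  by_cases hp : p.deg = 0
  · rw [eq_vert_of_deg_eq_zero hp, star_vert]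
    exact vert_mul_vert _
  · rw [star_s, sGhost_of_deg_ne_zero hp, s_of_deg_ne_zero hp, s_vert, ← map_mul, ← sub_eq_zero,
      ← map_sub]
    exact mk_eq_zero (.kp3_same p hp)

theorem star_s_mul_s_of_ne {p q : Λ.Path} (hd : p.deg = q.deg) (hne : p ≠ q) :
    star (s Λ R p) * s Λ R q = 0 := by
  by_cases hp : p.deg = 0
  · have hq := hd.symm.trans hp
    rw [eq_vert_of_deg_eq_zero hp, eq_vert_of_deg_eq_zero hq] at hne ⊢
    rw [star_vert]
    exact vert_mul_vert_of_ne fun h => hne (congrArg vert h)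
  · rw [star_s, sGhost_of_deg_ne_zero hp, s_of_deg_ne_zero (hd ▸ hp), ← map_mul]
    exact mk_eq_zero (.kp3_ne p q hp (hd ▸ hp) hd hne)

/-- This is (KP4), extended to `n = 0`, where the vertex is the only path. -/
theorem vert_eq_sum (hfin : Λ.RowFinite) (a : Λ.Vertex) (n : Fin k → ℕ) :
    s Λ R (vert a) = ∑ p ∈ (hfin a n).toFinset, s Λ R p * star (s Λ R p) := by
  by_cases hn : n = 0
  · subst hn
    rw [Finset.sum_eq_single (vert a), star_vert, vert_mul_vert]
    · intro p hp hne
      obtain ⟨hr, hd⟩ := (hfin a 0).mem_toFinset.mp hp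
      exact absurd ((eq_vert_of_deg_eq_zero hd).trans (congrArg vert hr)) hne
    · intro h
      exact absurd ((hfin a 0).mem_toFinset.mpr ⟨rfl, deg_vert a⟩) h
  · have h := mk_eq_zero (KPRelator.kp4 (R := R) a n hn)
    have := (hfin a n).to_subtype
    have := Fintype.ofFinite (Λ.pathsTo a n)
    rw [map_sub, sub_eq_zero, finsum_eq_sum_of_fintype, map_sum] at h
    rw [s_vert, h, Finset.sum_subtype _ (p := (· ∈ Λ.pathsTo a n))
      (fun p => (hfin a n).mem_toFinset)]
    refine Finset.sum_congr rfl fun p _ => ?_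
    rw [map_mul, star_s, s_of_deg_ne_zero (deg_ne_zero_of_mem hn p),
      sGhost_of_deg_ne_zero (deg_ne_zero_of_mem hn p)]

theorem s_mul_star_s_of_ne {p q : Λ.Path} (h : p.src ≠ q.src) :
    s Λ R p * star (s Λ R q) = 0 := by
  rw [← mul_vert_src p, ← mul_vert_src q, star_mul, star_vert, mul_assoc,
    ← mul_assoc (s Λ R (vert _)), vert_mul_vert_of_ne h, zero_mul, mul_zero]

/-- Inserting (KP4) at the common source raises both degrees by `n`. -/
theorem s_mul_star_s_eq_sum (hfin : Λ.RowFinite) {p q : Λ.Path} (h : p.src = q.src)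
    (n : Fin k → ℕ) : s Λ R p * star (s Λ R q) =
      ∑ r ∈ (hfin p.src n).toFinset, s Λ R (comp p r) * star (s Λ R (comp q r)) := by
  rw [← mul_vert_src p, vert_eq_sum hfin p.src n, Finset.mul_sum, Finset.sum_mul]
  refine Finset.sum_congr rfl fun r hr => ?_
  have hr' : r.rng = p.src := ((hfin _ n).mem_toFinset.mp hr).1
  rw [← s_mul_s hr', ← s_mul_s (hr'.trans h), star_mul]
  simp only [mul_assoc]

/-! ### The spanning elements -/

variable (Λ R) in
/-- The span of the elements `s_p s_q*` with `d(p) - d(q) = n`. -/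
def homogeneous (n : Fin k → ℤ) : Submodule R (Λ.KP R) :=
  Submodule.span R {a | ∃ p q : Λ.Path, p.degZ - q.degZ = n ∧ a = s Λ R p * star (s Λ R q)}

theorem s_mul_star_s_mem {p q : Λ.Path} {n : Fin k → ℤ} (h : p.degZ - q.degZ = n) :
    s Λ R p * star (s Λ R q) ∈ homogeneous Λ R n := Submodule.subset_span ⟨p, q, h, rfl⟩

/-- Extend both paths by (KP4) to the degree `d(p) ⊔ d(q)`. By (KP3) only the terms with `qa = pb`
survive, each equal to `s_a s_b*`, and comparing degrees gives `d(a) - d(b) = d(p) - d(q)`. -/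
theorem star_s_mul_s_mem (hfin : Λ.RowFinite) (p q : Λ.Path) :
    star (s Λ R q) * s Λ R p ∈ homogeneous Λ R (p.degZ - q.degZ) := by
  obtain ⟨m, hm⟩ := exists_add_of_le (le_sup_left : p.deg ≤ p.deg ⊔ q.deg)
  obtain ⟨n, hn⟩ := exists_add_of_le (le_sup_right : q.deg ≤ p.deg ⊔ q.deg)
  have h : star (s Λ R q) * s Λ R p =
      ∑ a ∈ (hfin q.src n).toFinset, ∑ b ∈ (hfin p.src m).toFinset,
        s Λ R a * (star (s Λ R (comp q a)) * s Λ R (comp p b)) * star (s Λ R b) := by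
    conv_lhs => rw [← mul_vert_src q, ← mul_vert_src p, star_mul, star_vert,
      vert_eq_sum hfin q.src n, vert_eq_sum hfin p.src m]
    simp only [Finset.sum_mul, Finset.mul_sum]
    refine Finset.sum_comm.trans (Finset.sum_congr rfl fun a ha => Finset.sum_congr rfl
      fun b hb => ?_)
    rw [← s_mul_s ((hfin _ n).mem_toFinset.mp ha).1, ← s_mul_s ((hfin _ m).mem_toFinset.mp hb).1,
      star_mul]
    simp only [mul_assoc]
  rw [h]
  refine Submodule.sum_mem _ fun a ha => Submodule.sum_mem _ fun b hb => ?_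
  obtain ⟨har, had⟩ := (hfin _ n).mem_toFinset.mp ha
  obtain ⟨hbr, hbd⟩ := (hfin _ m).mem_toFinset.mp hb
  have hd : (comp q a).deg = (comp p b).deg := by
    rw [deg_comp har, deg_comp hbr, had, hbd, ← hn, ← hm]
  by_cases he : comp q a = comp p b
  · rw [he, star_s_mul_s_self, ← he, src_comp har, mul_vert_src]
    refine s_mul_star_s_mem ?_
    have := congrArg degZ he
    rw [degZ_comp har, degZ_comp hbr] at this
    rw [sub_eq_sub_iff_add_eq_add, add_comm, this]
  · rw [star_s_mul_s_of_ne hd he, mul_zero, zero_mul]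
    exact zero_mem _

theorem mul_mem_homogeneous (hfin : Λ.RowFinite) {m n : Fin k → ℤ} {x y : Λ.KP R}
    (hx : x ∈ homogeneous Λ R m) (hy : y ∈ homogeneous Λ R n) :
    x * y ∈ homogeneous Λ R (m + n) := by
  -- The product `s_p s_q* s_a s_b*` is bracketed as `s_p (s_q* s_a) s_b*`: its middle is
  -- homogeneous, and this handles the outer factors.
  have hs : ∀ {p q r : Λ.Path} {n : Fin k → ℤ} {y : Λ.KP R}, y ∈ homogeneous Λ R n →
      s Λ R p * y * star (s Λ R r) ∈ homogeneous Λ R (p.degZ + n - r.degZ) := by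
    intro p q r n y hy
    induction hy using Submodule.span_induction with
    | mem y hy =>
      obtain ⟨a, b, rfl, rfl⟩ := hy
      rw [← mul_assoc, mul_assoc, ← star_mul]
      by_cases ha : a.rng = p.src
      · by_cases hb : b.rng = r.src
        · rw [s_mul_s ha, s_mul_s hb]
          refine s_mul_star_s_mem ?_
          rw [degZ_comp ha, degZ_comp hb]
          abel
        · rw [s_mul_s_of_ne hb, star_zero, mul_zero]
          exact zero_mem _
      · rw [s_mul_s_of_ne ha, zero_mul]
        exact zero_mem _
    | zero => rw [mul_zero, zero_mul]; exact zero_mem _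
    | add y z _ _ hy hz => rw [mul_add, add_mul]; exact add_mem hy hz
    | smul c y _ hy =>
      rw [mul_smul_comm, smul_mul_assoc]
      exact Submodule.smul_mem _ _ hy
  induction hx using Submodule.span_induction with
  | mem x hx =>
    obtain ⟨p, q, rfl, rfl⟩ := hx
    induction hy using Submodule.span_induction with
    | mem y hy =>
      obtain ⟨a, b, rfl, rfl⟩ := hy
      have := hs (p := p) (q := q) (r := b) (star_s_mul_s_mem (R := R) hfin a q)
      rw [show p.degZ + (a.degZ - q.degZ) - b.degZ = p.degZ - q.degZ + (a.degZ - b.degZ) by abel]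
        at this
      simpa only [mul_assoc] using this
    | zero => rw [mul_zero]; exact zero_mem _
    | add y z _ _ hy hz => rw [mul_add]; exact add_mem hy hz
    | smul c y _ hy => rw [mul_smul_comm]; exact Submodule.smul_mem _ _ hy
  | zero => rw [zero_mul]; exact zero_mem _
  | add y z _ _ hy hz => rw [add_mul]; exact add_mem hy hz
  | smul c y _ hy => rw [smul_mul_assoc]; exact Submodule.smul_mem _ _ hy

theorem mul_mem_iSup_homogeneous (hfin : Λ.RowFinite) {x y : Λ.KP R}
    (hx : x ∈ ⨆ n, homogeneous Λ R n) (hy : y ∈ ⨆ n, homogeneous Λ R n) :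
    x * y ∈ ⨆ n, homogeneous Λ R n := by
  induction hx using Submodule.iSup_induction' with
  | mem m x hx =>
    induction hy using Submodule.iSup_induction' with
    | mem n y hy => exact Submodule.mem_iSup_of_mem _ (mul_mem_homogeneous hfin hx hy)
    | zero => rw [mul_zero]; exact zero_mem _
    | add y z _ _ hy hz => rw [mul_add]; exact add_mem hy hz
  | zero => rw [zero_mul]; exact zero_mem _
  | add y z _ _ hy hz => rw [add_mul]; exact add_mem hy hz

theorem mk_ι_mem (g : Λ.Gen) : mk Λ R (FreeAlg.ι Λ R g) ∈ ⨆ n, homogeneous Λ R n := by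
  cases g with
  | vertex a =>
    rw [← s_vert, ← vert_mul_vert a]
    nth_rw 2 [← star_vert]
    exact Submodule.mem_iSup_of_mem _ (s_mul_star_s_mem rfl)
  | path p hp =>
    rw [← s_of_deg_ne_zero, ← mul_vert_src, ← star_vert]
    exact Submodule.mem_iSup_of_mem _ (s_mul_star_s_mem rfl)
  | ghost p hp =>
    rw [← sGhost_of_deg_ne_zero, ← star_s, ← mul_vert_src, star_mul, star_vert]
    exact Submodule.mem_iSup_of_mem _ (s_mul_star_s_mem rfl)

/-- The sum of the homogeneous parts contains the generators and is closed under products, hence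
contains all words. -/
theorem iSup_homogeneous (hfin : Λ.RowFinite) : ⨆ n, homogeneous Λ R n = ⊤ := by
  rw [Submodule.eq_top_iff']
  intro x
  obtain ⟨x, rfl⟩ := mk_surjective Λ R x
  induction x using MonoidAlgebra.induction_linear with
  | zero => rw [map_zero]; exact zero_mem _
  | add x y hx hy => rw [map_add]; exact add_mem hx hy
  | single w r =>
    have hw : mk Λ R (MonoidAlgebra.single w 1) ∈ ⨆ n, homogeneous Λ R n := by
      induction w using FreeSemigroup.recOnMul with
      | ih1 g => exact mk_ι_mem g
      | ih2 g w hg hw =>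
        have : (MonoidAlgebra.single (FreeSemigroup.of g * w) 1 : Λ.FreeAlg R) =
            MonoidAlgebra.single (FreeSemigroup.of g) 1 * MonoidAlgebra.single w 1 := by simp
        rw [this, map_mul]
        exact mul_mem_iSup_homogeneous hfin hg hw
    have : (MonoidAlgebra.single w r : Λ.FreeAlg R) = r • MonoidAlgebra.single w 1 := by simp
    rw [this, mk_smul]
    exact Submodule.smul_mem _ _ hw

variable (R) in
theorem span_s_mul_star_s (hfin : Λ.RowFinite) :
    Submodule.span R {a | ∃ p q : Λ.Path, a = s Λ R p * star (s Λ R q)} = ⊤ := by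
  rw [← top_le_iff, ← iSup_homogeneous hfin]
  refine iSup_le fun n => Submodule.span_mono ?_
  rintro _ ⟨p, q, -, rfl⟩
  exact ⟨p, q, rfl⟩

/-! ### Normal form with ghost paths of one common degree -/

variable (Λ) in
/-- The pairs of paths with the same source, the second one of degree `n`. -/
abbrev Pairs (n : Fin k → ℕ) : Type (max u v) :=
  {i : Λ.Path × Λ.Path // i.1.src = i.2.src ∧ i.2.deg = n}

variable (R) in
/-- The element `s_p s_q*` for a pair `(p, q)`. -/
def pairElement {n : Fin k → ℕ} (i : Pairs Λ n) : Λ.KP R := s Λ R i.1.1 * star (s Λ R i.1.2)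

theorem s_mul_star_s_mem_span (hfin : Λ.RowFinite) (p q : Λ.Path) {n : Fin k → ℕ}
    (hn : q.deg ≤ n) :
    s Λ R p * star (s Λ R q) ∈ Submodule.span R (Set.range (pairElement (Λ := Λ) R (n := n))) := by
  by_cases h : p.src = q.src
  · obtain ⟨m, rfl⟩ := exists_add_of_le hn
    rw [s_mul_star_s_eq_sum hfin h m]
    refine Submodule.sum_mem _ fun r hr => Submodule.subset_span ?_
    obtain ⟨hr, hd⟩ := (hfin _ m).mem_toFinset.mp hr
    refine ⟨⟨(comp p r, comp q r), ?_, ?_⟩, rfl⟩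
    · exact (src_comp hr).trans (src_comp (hr.trans h)).symm
    · exact (deg_comp (hr.trans h)).trans (by rw [hd])
  · rw [s_mul_star_s_of_ne h]
    exact zero_mem _

/-- These spans increase with `n`, and `ℕ^k` is directed, so finitely many terms can be brought to
one `n`. Only the degree of the ghost path is fixed. -/
theorem exists_mem_span (hfin : Λ.RowFinite) (x : Λ.KP R) :
    ∃ n, x ∈ Submodule.span R (Set.range (pairElement (Λ := Λ) R (n := n))) := by
  have hmono : ∀ {m n : Fin k → ℕ}, m ≤ n →
      Submodule.span R (Set.range (pairElement (Λ := Λ) R (n := m))) ≤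
        Submodule.span R (Set.range (pairElement (Λ := Λ) R (n := n))) := by
    intro m n hmn
    rw [Submodule.span_le]
    rintro _ ⟨i, rfl⟩
    exact s_mul_star_s_mem_span hfin _ _ (i.2.2.le.trans hmn)
  have hx : x ∈ Submodule.span R {a | ∃ p q : Λ.Path, a = s Λ R p * star (s Λ R q)} := by
    rw [span_s_mul_star_s R hfin]; trivial
  induction hx using Submodule.span_induction with
  | mem x hx =>
    obtain ⟨p, q, rfl⟩ := hx
    exact ⟨_, s_mul_star_s_mem_span hfin p q le_rfl⟩
  | zero => exact ⟨0, zero_mem _⟩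
  | add x y _ _ hx hy =>
    obtain ⟨m, hm⟩ := hx
    obtain ⟨n, hn⟩ := hy
    exact ⟨m ⊔ n, add_mem (hmono le_sup_left hm) (hmono le_sup_right hn)⟩
  | smul c x _ hx =>
    obtain ⟨m, hm⟩ := hx
    exact ⟨m, Submodule.smul_mem _ _ hm⟩

end Relations

/-! ### The universal property -/

section Lift

variable {R : Type w} [CommRing R] {B : Type*} [NonUnitalRing B] [Module R B]

/-- The kernel of `φ` is one of the ideals whose intersection defines `kpIdeal`. -/
theorem map_eq_zero_of_mem_kpIdeal {φ : Λ.FreeAlg R →ₙₐ[R] B}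
    (hφ : ∀ x, Λ.KPRelator R x → φ x = 0) {x : Λ.FreeAlg R} (hx : x ∈ Λ.kpIdeal R) : φ x = 0 := by
  rw [kpIdeal, TwoSidedIdeal.mem_sInf] at hx
  refine (TwoSidedIdeal.mem_ker φ).mp (hx (TwoSidedIdeal.ker φ) ⟨fun r y hy => ?_, fun y hy => ?_⟩)
  · rw [TwoSidedIdeal.mem_ker] at hy ⊢
    rw [map_smul, hy, smul_zero]
  · exact (TwoSidedIdeal.mem_ker φ).mpr (hφ y hy)

/-- The homomorphism on the Kumjian-Pask algebra induced by a homomorphism on the free algebra that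
kills the relators. -/
def lift (φ : Λ.FreeAlg R →ₙₐ[R] B) (hφ : ∀ x, Λ.KPRelator R x → φ x = 0) : Λ.KP R →ₙₐ[R] B where
  toFun := Quotient.lift φ fun x y h => by
    have h' : x - y ∈ Λ.kpIdeal R := (TwoSidedIdeal.rel_iff _ x y).mp h
    rw [← sub_eq_zero, ← map_sub]
    exact map_eq_zero_of_mem_kpIdeal hφ h'
  map_smul' r x := by
    obtain ⟨x, rfl⟩ := mk_surjective Λ R x
    exact map_smul φ r x
  map_zero' := map_zero φ
  map_add' x y := by
    obtain ⟨x, rfl⟩ := mk_surjective Λ R x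
    obtain ⟨y, rfl⟩ := mk_surjective Λ R y
    exact map_add φ x y
  map_mul' x y := by
    obtain ⟨x, rfl⟩ := mk_surjective Λ R x
    obtain ⟨y, rfl⟩ := mk_surjective Λ R y
    exact map_mul φ x y

theorem lift_mk (φ : Λ.FreeAlg R →ₙₐ[R] B) (hφ : ∀ x, Λ.KPRelator R x → φ x = 0)
    (x : Λ.FreeAlg R) : lift φ hφ (mk Λ R x) = φ x := rfl

end Lift

section CStarLift

variable {B : Type*} [NonUnitalCStarAlgebra B] {S : Λ.Path → B}

/-- The values of a Cuntz-Krieger family on the generators of the Kumjian-Pask algebra. -/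
def genMap (S : Λ.Path → B) : Λ.Gen → B
  | .vertex a => S (vert a)
  | .path p _ => S p
  | .ghost p _ => star (S p)

/-- The homomorphism on the free algebra given by a Cuntz-Krieger family. -/
def freeLift (S : Λ.Path → B) : Λ.FreeAlg ℂ →ₙₐ[ℂ] B :=
  MonoidAlgebra.liftMagma ℂ (FreeSemigroup.lift (genMap S))

theorem freeLift_ι (S : Λ.Path → B) (g : Λ.Gen) : freeLift S (FreeAlg.ι Λ ℂ g) = genMap S g := by
  simp [freeLift, FreeAlg.ι]

/-- The case `kp3_ne` is the one that needs the target to be a C*-algebra. -/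
theorem freeLift_relator (hfin : Λ.RowFinite) (hS : Λ.IsCKFamily S) {x : Λ.FreeAlg ℂ}
    (hx : Λ.KPRelator ℂ x) : freeLift S x = 0 := by
  cases hx with
  | kp1_same a => simp [freeLift_ι, genMap, hS.vert_idem]
  | kp1_ne a b h => simp [freeLift_ι, genMap, hS.vert_orthogonal a b h]
  | kp2_path f g hf hg => simp [freeLift_ι, genMap, hS.comp]
  | kp2_ghost f g hf hg => simp [freeLift_ι, genMap, ← star_mul, hS.comp]
  | kp2_rng_path p hp => simp [freeLift_ι, genMap, hS.vert_rng_mul]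
  | kp2_path_src p hp => simp [freeLift_ι, genMap, hS.mul_vert_src]
  | kp2_src_ghost p hp => simp [freeLift_ι, genMap, hS.vert_src_mul_star]
  | kp2_ghost_rng p hp => simp [freeLift_ι, genMap, hS.star_mul_vert_rng]
  | kp3_same p hp => simp [freeLift_ι, genMap, hS.star_mul_self]
  | kp3_ne p q hp hq hd hne => simp [freeLift_ι, genMap, hS.star_mul_eq_zero hfin hd hne]
  | kp4 a n hn =>
    have := (hfin a n).to_subtype
    have := Fintype.ofFinite (Λ.pathsTo a n)
    have h := hS.sum_range a n
    rw [finsum_eq_sum_of_fintype] at h ⊢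
    rw [map_sub, map_sum, freeLift_ι]
    simp only [map_mul, freeLift_ι, genMap]
    rw [← h, sub_self]

/-- The homomorphism on the Kumjian-Pask algebra given by a Cuntz-Krieger family. -/
def ckLift (hfin : Λ.RowFinite) (hS : Λ.IsCKFamily S) : Λ.KP ℂ →ₙₐ[ℂ] B :=
  lift (freeLift S) fun _ => freeLift_relator hfin hS

theorem ckLift_s (hfin : Λ.RowFinite) (hS : Λ.IsCKFamily S) (p : Λ.Path) :
    ckLift hfin hS (s Λ ℂ p) = S p := by
  by_cases hp : p.deg = 0
  · rw [eq_vert_of_deg_eq_zero hp, s_vert, ckLift, lift_mk, freeLift_ι]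
    rfl
  · rw [s_of_deg_ne_zero hp, ckLift, lift_mk, freeLift_ι]
    rfl

theorem ckLift_star_s (hfin : Λ.RowFinite) (hS : Λ.IsCKFamily S) (p : Λ.Path) :
    ckLift hfin hS (star (s Λ ℂ p)) = star (S p) := by
  rw [star_s]
  by_cases hp : p.deg = 0
  · rw [eq_vert_of_deg_eq_zero hp, sGhost_vert, ckLift, lift_mk, freeLift_ι, hS.vert_star]
    rfl
  · rw [sGhost_of_deg_ne_zero hp, ckLift, lift_mk, freeLift_ι]
    rfl

/-- The `*`-homomorphism on the Kumjian-Pask algebra given by a Cuntz-Krieger family. -/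
def ckStarLift (hfin : Λ.RowFinite) (hS : Λ.IsCKFamily S) : Λ.KP ℂ →⋆ₙₐ[ℂ] B where
  __ := ckLift hfin hS
  map_star' x := by
    change ckLift hfin hS (star x) = star (ckLift hfin hS x)
    -- Compatibility with the involution need only be checked on the spanning elements `s_p s_q*`.
    have hx : x ∈ Submodule.span ℂ {a | ∃ p q : Λ.Path, a = s Λ ℂ p * star (s Λ ℂ q)} := by
      rw [span_s_mul_star_s ℂ hfin]; trivial
    induction hx using Submodule.span_induction with
    | mem x hx =>
      obtain ⟨p, q, rfl⟩ := hx
      simp only [star_mul, star_star, map_mul, ckLift_s, ckLift_star_s]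
    | zero => simp only [star_zero, map_zero]
    | add x y _ _ hx hy => simp only [star_add, map_add, hx, hy]
    | smul c x _ hx => simp only [star_smul, map_smul, hx]

theorem ckStarLift_s (hfin : Λ.RowFinite) (hS : Λ.IsCKFamily S) (p : Λ.Path) :
    ckStarLift hfin hS (s Λ ℂ p) = S p := ckLift_s hfin hS p

end CStarLift

end KP

end KGraph

end

noncomputable section

namespace KGraph

open KGraph.Path

variable {k : ℕ} {Λ : KGraph.{u, v} k}

/-! ### Matrix coefficients of the twisted infinite path representation -/

theorem snd_of_shift_eq_some {p : Λ.Path} {a b : Λ.InfPath × (Fin k → ℤ)}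
    (h : shift p a = some b) : b.2 = a.2 + p.degZ := by
  obtain ⟨x, m⟩ := a
  by_cases hx : x.rng = p.src
  · rw [shift_apply p hx, Option.some.injEq] at h
    rw [← h]
  · rw [shift_apply_of_ne p hx] at h
    cases h

/-- The representation of the `k`-graph on `ℓ²(Λ^∞ × ℤ^k)`. -/
def pathRep (hfin : Λ.RowFinite) : Λ.CKRep where
  H := lp (fun _ : Λ.InfPath × (Fin k → ℤ) => ℂ) 2
  S p := (shift p).lpMap
  isCKFamily := isCKFamily_lpMap_shift hfin

open Classical in
/-- The matrix coefficient at `(b, a)` of an operator on `ℓ²`. -/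
def matrixCoef {ι : Type*} (a b : ι) :
    (lp (fun _ : ι => ℂ) 2 →L[ℂ] lp (fun _ : ι => ℂ) 2) →ₗ[ℂ] ℂ where
  toFun T := T (lp.single 2 a 1) b
  map_add' _ _ := rfl
  map_smul' _ _ := rfl

theorem eq_zero_of_matrixCoef {ι : Type*} {T : lp (fun _ : ι => ℂ) 2 →L[ℂ] lp (fun _ : ι => ℂ) 2}
    (h : ∀ a b, matrixCoef a b T = 0) : T = 0 := by
  classical
  refine lp.ext_continuousLinearMap (by simp) fun a => ?_
  ext b
  exact h a b

open Classical in
theorem matrixCoef_lpMap_mul {ι : Type*} (f g : ι ≃. ι) (a b : ι) :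
    matrixCoef a b (f.lpMap * star g.lpMap) = if (g.symm a).bind f = some b then 1 else 0 := by
  rw [PEquiv.star_lpMap, ← PEquiv.lpMap_trans]
  change (g.symm.trans f).lpMap (lp.single 2 a 1) b = if g.symm.trans f a = some b then 1 else 0
  cases h : g.symm.trans f a with
  | none => rw [PEquiv.lpMap_single_of_eq_none _ h]; rfl
  | some c =>
    rw [PEquiv.lpMap_single _ h]
    split_ifs with hc
    · rw [Option.some_injective _ hc, lp.single_apply_self]
    · rw [lp.single_apply_ne]
      rintro rfl
      exact hc rfl

/-- Evaluation of elements of `C*(Λ)` in the path representation. -/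
def pathEval (hfin : Λ.RowFinite) : Λ.CStar →⋆ₙₐ[ℂ]
    (lp (fun _ : Λ.InfPath × (Fin k → ℤ) => ℂ) 2 →L[ℂ]
      lp (fun _ : Λ.InfPath × (Fin k → ℤ) => ℂ) 2) :=
  CStar.eval (pathRep hfin)

theorem pathEval_t (hfin : Λ.RowFinite) (p : Λ.Path) :
    pathEval hfin (CStar.t Λ p) = (shift p).lpMap := rfl

/-- `S_p*` and `S_q*` lower the `ℤ^k` coordinate by the degree and `S_p` raises it, so an element of
`A_n` moves it by exactly `n`. -/
theorem matrixCoef_eq_zero_of_mem_homogeneous (hfin : Λ.RowFinite) {n : Fin k → ℤ} {x : Λ.CStar}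
    (hx : x ∈ CStar.homogeneous Λ n) {a b : Λ.InfPath × (Fin k → ℤ)} (hab : b.2 ≠ a.2 + n) :
    matrixCoef a b (pathEval hfin x) = 0 := by
  induction hx using Submodule.span_induction with
  | mem x hx =>
    obtain ⟨p, q, hn, rfl⟩ := hx
    rw [map_mul, map_star, pathEval_t, pathEval_t, matrixCoef_lpMap_mul, if_neg]
    intro h
    obtain ⟨c, hc, hcb⟩ := Option.bind_eq_some_iff.mp h
    have h1 := snd_of_shift_eq_some ((shift q).eq_some_iff.mp hc)
    have h2 := snd_of_shift_eq_some hcb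
    have h3 : p.degZ - q.degZ = n := funext hn
    apply hab
    rw [h1, h2, ← h3]
    abel
  | zero => rw [map_zero, map_zero]
  | add x y _ _ hx hy => rw [map_add, map_add, hx, hy, add_zero]
  | smul c x _ hx => rw [map_smul, map_smul, hx, smul_zero]

theorem linearIndependent_shift_mul_star_shift (hsrc : Λ.NoSources) (n : Fin k → ℕ) :
    LinearIndependent ℂ fun i : KP.Pairs Λ n =>
      (shift i.1.1).lpMap * star (shift i.1.2).lpMap := by
  choose x hx using InfPath.exists_rng_eq hsrc
  -- For a pair `(p, q)` these are the points `(qx, d(q))` and `(px, d(p))`, with `x` a chosen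
  -- infinite path from the common source; their matrix coefficients form a dual family.
  let A : KP.Pairs Λ n → Λ.InfPath × (Fin k → ℤ) := fun i =>
    (InfPath.cons i.1.2 (x i.1.2.src) (hx _), 0 + i.1.2.degZ)
  let B : KP.Pairs Λ n → Λ.InfPath × (Fin k → ℤ) := fun i =>
    (InfPath.cons i.1.1 (x i.1.2.src) ((hx _).trans i.2.1.symm), 0 + i.1.1.degZ)
  have hA : ∀ i, (shift i.1.2).symm (A i) = some (x i.1.2.src, 0) := fun i =>
    (shift i.1.2).eq_some_iff.mpr (shift_apply _ (hx _) _)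
  refine LinearIndependent.of_pairwise_dual_eq_zero_one _ (fun i => matrixCoef (A i) (B i)) ?_ ?_
  · intro i j hij
    change matrixCoef (A i) (B i) _ = 0
    rw [matrixCoef_lpMap_mul, if_neg]
    intro h
    obtain ⟨c, hc, hcb⟩ := Option.bind_eq_some_iff.mp h
    -- The common degree `n` matters here: both ghost paths are the segment of degree `n` of the
    -- same infinite path.
    have hq : i.1.2 = j.1.2 := by
      have h1 := (isSome_shift_symm j.1.2 (A i)).mp (by rw [hc]; rfl)
      rw [j.2.2.trans i.2.2.symm] at h1
      exact (InfPath.seg_cons_deg _ _ (hx _)).symm.trans h1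
    rw [← hq, hA, Option.some.injEq] at hc
    subst hc
    -- The degrees of the first paths are not fixed in advance; the `ℤ^k` coordinate forces them to
    -- agree.
    have hd : i.1.1.degZ = j.1.1.degZ := by
      have := snd_of_shift_eq_some hcb
      exact add_left_cancel this
    have hp : i.1.1 = j.1.1 := by
      have h1 := (isSome_shift_symm j.1.1 (B i)).mp (by
        rw [(shift j.1.1).eq_some_iff.mpr hcb]; rfl)
      rw [← degZ_injective hd] at h1
      exact (InfPath.seg_cons_deg _ _ ((hx _).trans i.2.1.symm)).symm.trans h1
    exact hij (Subtype.ext (Prod.ext hp hq))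
  · intro i
    rw [matrixCoef_lpMap_mul, if_pos]
    rw [hA, Option.bind_some]
    exact shift_apply _ _ _

/-! ### The canonical homomorphism: injectivity, image, grading and density -/

namespace CStar

variable (Λ) in
/-- The canonical homomorphism from the Kumjian-Pask algebra to `C*(Λ)`. -/
def ofKP (hfin : Λ.RowFinite) : Λ.KP ℂ →⋆ₙₐ[ℂ] Λ.CStar :=
  KP.ckStarLift hfin (isCKFamily_t hfin)

theorem ofKP_s (hfin : Λ.RowFinite) (p : Λ.Path) : ofKP Λ hfin (KP.s Λ ℂ p) = t Λ p :=
  KP.ckStarLift_s hfin _ p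

theorem ofKP_s_mul_star_s (hfin : Λ.RowFinite) (p q : Λ.Path) :
    ofKP Λ hfin (KP.s Λ ℂ p * star (KP.s Λ ℂ q)) = t Λ p * star (t Λ q) := by
  rw [map_mul, map_star, ofKP_s, ofKP_s]

/-- In normal form, `x` is sent to a combination of linearly independent operators, so all its
coefficients vanish. The path representation is thus faithful on `A`, though perhaps not on `C*(Λ)`.
-/
theorem pathEval_ofKP_injective (hfin : Λ.RowFinite) (hsrc : Λ.NoSources) {x : Λ.KP ℂ}
    (hx : pathEval hfin (ofKP Λ hfin x) = 0) : x = 0 := by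
  obtain ⟨n, hn⟩ := KP.exists_mem_span hfin x
  obtain ⟨c, rfl⟩ := (Finsupp.mem_span_range_iff_exists_finsupp).mp hn
  have hc : c = 0 := by
    refine (linearIndependent_iff.mp (linearIndependent_shift_mul_star_shift hsrc n)) c ?_
    rw [← hx, Finsupp.linearCombination_apply, Finsupp.sum, Finsupp.sum, map_sum, map_sum]
    refine Finset.sum_congr rfl fun i _ => ?_
    rw [map_smul, map_smul, KP.pairElement, ofKP_s_mul_star_s, map_mul, map_star, pathEval_t,
      pathEval_t]
  rw [hc, Finsupp.sum_zero_index]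

theorem ofKP_injective (hfin : Λ.RowFinite) (hsrc : Λ.NoSources) :
    Function.Injective (ofKP Λ hfin) := by
  refine (injective_iff_map_eq_zero _).mpr fun x hx => pathEval_ofKP_injective hfin hsrc ?_
  rw [hx, map_zero]

theorem map_homogeneous (hfin : Λ.RowFinite) (n : Fin k → ℤ) :
    (KP.homogeneous Λ ℂ n).map (ofKP Λ hfin : Λ.KP ℂ →ₗ[ℂ] Λ.CStar) = homogeneous Λ n := by
  rw [KP.homogeneous, Submodule.map_span, homogeneous]
  congr 1
  ext a
  constructor
  · rintro ⟨_, ⟨p, q, hn, rfl⟩, rfl⟩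
    exact ⟨p, q, fun i => congrFun hn i, ofKP_s_mul_star_s hfin p q⟩
  · rintro ⟨p, q, hn, rfl⟩
    exact ⟨_, ⟨p, q, funext hn, rfl⟩, ofKP_s_mul_star_s hfin p q⟩

theorem range_ofKP (hfin : Λ.RowFinite) :
    LinearMap.range (ofKP Λ hfin : Λ.KP ℂ →ₗ[ℂ] Λ.CStar) = spanning Λ := by
  rw [LinearMap.range_eq_map, ← KP.span_s_mul_star_s ℂ hfin, Submodule.map_span, spanning]
  congr 1
  ext a
  constructor
  · rintro ⟨_, ⟨p, q, rfl⟩, rfl⟩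
    exact ⟨p, q, ofKP_s_mul_star_s hfin p q⟩
  · rintro ⟨p, q, rfl⟩
    exact ⟨_, ⟨p, q, rfl⟩, ofKP_s_mul_star_s hfin p q⟩

theorem coe_range_ofKP (hfin : Λ.RowFinite) :
    Set.range (ofKP Λ hfin) = (spanning Λ : Set Λ.CStar) := by
  rw [← range_ofKP hfin]
  rfl

theorem iSup_homogeneous (hfin : Λ.RowFinite) : ⨆ n, homogeneous Λ n = spanning Λ := by
  simp_rw [← map_homogeneous hfin]
  rw [← Submodule.map_iSup, KP.iSup_homogeneous hfin, ← LinearMap.range_eq_map, range_ofKP]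

theorem mul_mem_homogeneous (hfin : Λ.RowFinite) {m n : Fin k → ℤ} {a b : Λ.CStar}
    (ha : a ∈ homogeneous Λ m) (hb : b ∈ homogeneous Λ n) : a * b ∈ homogeneous Λ (m + n) := by
  rw [← map_homogeneous hfin] at ha hb ⊢
  obtain ⟨x, hx, rfl⟩ := ha
  obtain ⟨y, hy, rfl⟩ := hb
  exact ⟨x * y, KP.mul_mem_homogeneous hfin hx hy, map_mul (ofKP Λ hfin) x y⟩

/-- Let `a` lie in `A_n` and in the sum of the other parts. Coefficients that move the `ℤ^k`
coordinate by `n` vanish for the second reason, all others for the first, so the path representation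
kills `a`; it is faithful on `A`. -/
theorem iSupIndep_homogeneous (hfin : Λ.RowFinite) (hsrc : Λ.NoSources) :
    iSupIndep (homogeneous Λ) := by
  intro n
  rw [Submodule.disjoint_def]
  intro a ha ha'
  have hcoef : ∀ (i : Λ.InfPath × (Fin k → ℤ)) (y : Λ.InfPath),
      matrixCoef i (y, i.2 + n) (pathEval hfin a) = 0 := by
    intro i y
    have hle : ⨆ (j) (_ : j ≠ n), homogeneous Λ j ≤
        LinearMap.ker ((matrixCoef i (y, i.2 + n)).comp
          (pathEval hfin : Λ.CStar →ₗ[ℂ] _)) := by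
      refine iSup₂_le fun j hj x hx => ?_
      exact matrixCoef_eq_zero_of_mem_homogeneous hfin hx fun h => hj (add_left_cancel h).symm
    exact hle ha'
  have h0 : pathEval hfin a = 0 := by
    refine eq_zero_of_matrixCoef fun i j => ?_
    by_cases hj : j.2 = i.2 + n
    · obtain ⟨y, m⟩ := j
      obtain rfl : m = i.2 + n := hj
      exact hcoef i y
    · exact matrixCoef_eq_zero_of_mem_homogeneous hfin ha hj
  rw [← map_homogeneous hfin] at ha
  obtain ⟨x, -, rfl⟩ := ha
  have hx : x = 0 := pathEval_ofKP_injective hfin hsrc h0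
  rw [hx, map_zero]

theorem dense_spanning (hfin : Λ.RowFinite) : Dense (spanning Λ : Set Λ.CStar) := by
  have hle : ∀ y ∈ NonUnitalStarAlgebra.adjoin ℂ (Set.range Λ.universalFamily),
      ∃ a ∈ spanning Λ, a.1 = y := by
    -- As the range of a `*`-homomorphism, `A` is closed under products and the involution.
    have hmem : ∀ a, a ∈ spanning Λ ↔ ∃ x, ofKP Λ hfin x = a := fun a => by
      rw [← SetLike.mem_coe, ← coe_range_ofKP hfin, Set.mem_range]
    intro y hy
    induction hy using NonUnitalStarAlgebra.adjoin_induction with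
    | mem y hy =>
      obtain ⟨p, rfl⟩ := hy
      exact ⟨t Λ p, (hmem _).mpr ⟨_, ofKP_s hfin p⟩, rfl⟩
    | add y z _ _ hy hz =>
      obtain ⟨a, ha, rfl⟩ := hy
      obtain ⟨b, hb, rfl⟩ := hz
      exact ⟨a + b, add_mem ha hb, rfl⟩
    | zero => exact ⟨0, zero_mem _, rfl⟩
    | mul y z _ _ hy hz =>
      obtain ⟨a, ha, rfl⟩ := hy
      obtain ⟨b, hb, rfl⟩ := hz
      obtain ⟨x, rfl⟩ := (hmem _).mp ha
      obtain ⟨y, rfl⟩ := (hmem _).mp hb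
      exact ⟨_, (hmem _).mpr ⟨x * y, map_mul _ _ _⟩, rfl⟩
    | smul c y _ hy =>
      obtain ⟨a, ha, rfl⟩ := hy
      exact ⟨c • a, Submodule.smul_mem _ _ ha, rfl⟩
    | star y _ hy =>
      obtain ⟨a, ha, rfl⟩ := hy
      obtain ⟨x, rfl⟩ := (hmem _).mp ha
      exact ⟨_, (hmem _).mpr ⟨star x, map_star _ _⟩, rfl⟩
  intro a
  have ha : a.1 ∈ closure (NonUnitalStarAlgebra.adjoin ℂ (Set.range Λ.universalFamily) :
      Set Λ.RepProduct) := a.2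
  refine Metric.mem_closure_iff.mpr fun ε hε => ?_
  obtain ⟨y, hy, hd⟩ := Metric.mem_closure_iff.mp ha ε hε
  obtain ⟨b, hb, rfl⟩ := hle y hy
  exact ⟨b, hb, hd⟩

end CStar

end KGraph

end

theorem proposition7p3 {k : ℕ} (hk : 0 < k) (Λ : KGraph.{u, v} k)
    (hfin : Λ.RowFinite) (hsrc : Λ.NoSources) :
    ∃ π : Λ.KP ℂ →⋆ₙₐ[ℂ] Λ.CStar,
      -- `π` is the canonical homomorphism, determined by its values on the generators
      ((∀ p : Λ.Path, π (KGraph.KP.s Λ ℂ p) = KGraph.CStar.t Λ p) ∧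
        (∀ p : Λ.Path, π (KGraph.KP.sGhost Λ ℂ p) = star (KGraph.CStar.t Λ p)) ∧
        (∀ ρ : Λ.KP ℂ →ₙₐ[ℂ] Λ.CStar,
          (∀ p : Λ.Path, ρ (KGraph.KP.s Λ ℂ p) = KGraph.CStar.t Λ p) →
          (∀ p : Λ.Path, ρ (KGraph.KP.sGhost Λ ℂ p) = star (KGraph.CStar.t Λ p)) →
          ∀ x, ρ x = π x)) ∧
      (∀ p q : Λ.Path, π (KGraph.KP.s Λ ℂ p * KGraph.KP.sGhost Λ ℂ q) =
        KGraph.CStar.t Λ p * star (KGraph.CStar.t Λ q)) ∧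
      -- `π` is an isomorphism onto the dense `*`-subalgebra `A`
      Function.Injective π ∧
      Set.range π = (KGraph.CStar.spanning Λ : Set Λ.CStar) ∧
      Dense (KGraph.CStar.spanning Λ : Set Λ.CStar) ∧
      -- the subspaces `A_n` form a `ℤ^k`-grading of `A`
      ((∀ (m n : Fin k → ℤ), ∀ a ∈ KGraph.CStar.homogeneous Λ m,
          ∀ b ∈ KGraph.CStar.homogeneous Λ n, a * b ∈ KGraph.CStar.homogeneous Λ (m + n)) ∧
        iSupIndep (KGraph.CStar.homogeneous Λ) ∧
        ⨆ n : Fin k → ℤ, KGraph.CStar.homogeneous Λ n = KGraph.CStar.spanning Λ) := by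
  refine ⟨KGraph.CStar.ofKP Λ hfin, ⟨KGraph.CStar.ofKP_s hfin, fun p => ?_, fun ρ h1 h2 x => ?_⟩,
    fun p q => ?_, KGraph.CStar.ofKP_injective hfin hsrc, KGraph.CStar.coe_range_ofKP hfin,
    KGraph.CStar.dense_spanning hfin,
    fun m n a ha b hb => KGraph.CStar.mul_mem_homogeneous hfin ha hb,
    KGraph.CStar.iSupIndep_homogeneous hfin hsrc, KGraph.CStar.iSup_homogeneous hfin⟩
  · rw [← KGraph.KP.star_s, map_star, KGraph.CStar.ofKP_s]
  -- Uniqueness: `ρ` is only assumed to be an algebra homomorphism, but its values on the elements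
  -- `s_p s_q*`, which span, are prescribed.
  · have hx : x ∈ Submodule.span ℂ
        {a | ∃ p q : Λ.Path, a = KGraph.KP.s Λ ℂ p * star (KGraph.KP.s Λ ℂ q)} := by
      rw [KGraph.KP.span_s_mul_star_s ℂ hfin]; trivial
    induction hx using Submodule.span_induction with
    | mem x hx =>
      obtain ⟨p, q, rfl⟩ := hx
      rw [KGraph.CStar.ofKP_s_mul_star_s, map_mul, h1, KGraph.KP.star_s, h2]
    | zero => rw [map_zero, map_zero]
    | add x y _ _ hx hy => rw [map_add, map_add, hx, hy]
    | smul c x _ hx => rw [map_smul, map_smul, hx]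
  · rw [← KGraph.KP.star_s, KGraph.CStar.ofKP_s_mul_star_s]
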